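/- Let $G_U=(V_U,E_U)$ be a connected network on $n$ nodes with diameter $D$, and let $G_K=(V_K,E_K)$ be a graph isomorphic to $G_U$, where $V_K=\{0,\dots,n-1\}$. In the CONGEST model the nodes of $G_U$ compute in synchronous rounds; in each round every node sends a message of $O(\log n)$ bits over each of its incident edges; local computation is unbounded. Initially each node knows $G_K$, the proximity parameter $\epsilon\in(0,1)$, its own identifier (the identifiers are distinct non-negative integers, at most polynomial in $n$), its degree (the incident edges being accessible through arbitrarily numbered ports), and its own private random seed, independent of the seeds of the other nodes. **Theorem.** For all $a,c\in\mathbb N$ there is a randomized CONGEST algorithm with the following property, where the constants in the $O$-bounds on the message length and on the number of rounds depend only on $a$ and $c$. For every $n$, every connected $n$-node network $G_U$ with distinct identifiers in $\{0,\dots,n^a\}$ and any port numbering, every graph $G_K$ on $\{0,\dots,n-1\}$ that is isomorphic to $G_U$, and every $\epsilon\in(0,1)$, the algorithm, with $G_K$ and $\epsilon$ given to all nodes, runs for $O\big(D+(\epsilon^{-1}\log n)^2\big)$ rounds, and with probability at least $1-n^{-c}$ every node $v\in V_U$ outputs a node $g(v)\in V_K$ such that $g:V_U\to V_K$ is a bijection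 and $g(G_U)$ is $\epsilon$-close to $G_K$. Here $g(G_U)$ is the graph on $V_K$ with edge set $\{\{g(u),g(v)\}:\{u,v\}\in E_U\}$, and $\epsilon$-close means that the adjacency matrices of the two graphs differ in fewer than $\epsilon n^2$ entries. -/

import Mathlib

/-! ### The synchronous CONGEST model with private randomness -/

namespace Congest

/-- A port numbering of the network `G`: node `v` has ports `0, …, deg v - 1`, which are in
bijection with its neighbours (so `deg v` is the degree of `v`). -/
structure PortNumbering {V : Type*} (G : SimpleGraph V) where
  deg : V → ℕ
  nbr : ∀ v, Fin (deg v) ≃ G.neighborSet v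

/-- A message is a word of `b` bits. -/
abbrev Msg (b : ℕ) : Type := Fin b → Bool

/-- A randomized synchronous message-passing algorithm with `b`-bit messages and outputs in `Out`.
Every node runs the same algorithm; local computation is unbounded. At the start a node knows its
identifier, its degree and its own private random seed, which is drawn uniformly at random from
the finite nonempty set `Seed`. In each round it sends one `b`-bit message through each of its
ports, receives one through each of them, and updates its state. After `rounds` rounds all nodes
stop, and each node reads its output off its state (`none` meaning that it has no output). -/
structure Algorithm (b : ℕ) (Out : Type) where
  State : Type
  Seed : Type
  finite_seed : Finite Seed
  nonempty_seed : Nonempty Seed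
  /-- initial state, from identifier, degree and private seed -/
  init : (ident deg : ℕ) → Seed → State
  /-- the message sent through each port -/
  send : (deg : ℕ) → State → Fin deg → Msg b
  /-- the new state, from the old one and the messages received through the ports -/
  step : (deg : ℕ) → State → (Fin deg → Msg b) → State
  rounds : ℕ
  output : State → Option Out

namespace PortNumbering

variable {V : Type*} {G : SimpleGraph V}

/-- If each node `u` sends the message `sent u q` through its port `q`, then this is what `v`
receives through its port `p`: the message which the neighbour `u` behind `p` sends through the
port of `u` that leads to `v`. -/
def received (P : PortNumbering G) {b : ℕ} (sent : ∀ u, Fin (P.deg u) → Msg b)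
    (v : V) (p : Fin (P.deg v)) : Msg b :=
  sent (P.nbr v p).1 ((P.nbr (P.nbr v p).1).symm ⟨v, (P.nbr v p).2.symm⟩)

end PortNumbering

namespace Algorithm

variable {V : Type*} {G : SimpleGraph V} {b : ℕ} {Out : Type}

/-- The states of all nodes after `t` rounds, in the network `G` with ports `P` and identifiers
`ident`, when node `v` has drawn the seed `ω v`. -/
def stateAt (A : Algorithm b Out) (P : PortNumbering G) (ident : V → ℕ) (ω : V → A.Seed) :
    ℕ → V → A.State
  | 0 => fun v => A.init (ident v) (P.deg v) (ω v)
  | t + 1 => fun v =>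
      A.step (P.deg v) (A.stateAt P ident ω t v)
        (P.received (fun u => A.send (P.deg u) (A.stateAt P ident ω t u)) v)

/-- The outputs of all nodes. -/
def result (A : Algorithm b Out) (P : PortNumbering G) (ident : V → ℕ) (ω : V → A.Seed) (v : V) :
    Option Out :=
  A.output (A.stateAt P ident ω A.rounds v)

/-- The probability that the outputs of the nodes satisfy `E`. The seeds of the nodes are
independent and uniform, that is, `ω` is uniform in the finite set `V → A.Seed`. -/
noncomputable def prob (A : Algorithm b Out) (P : PortNumbering G) (ident : V → ℕ)
    (E : (V → Option Out) → Prop) : ℝ :=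
  ({ω : V → A.Seed | E (A.result P ident ω)}.ncard : ℝ) / (Nat.card (V → A.Seed) : ℝ)

end Algorithm

/-- The Hamming distance between the adjacency matrices of two graphs on the same nodes. -/
noncomputable def adjDist {W : Type*} (G H : SimpleGraph W) : ℕ :=
  {p : W × W | ¬ (G.Adj p.1 p.2 ↔ H.Adj p.1 p.2)}.ncard

/-- The outputs of the nodes of `GU` form a bijection `g` from the nodes of `GU` onto those of
`GK`, and the graph `g(GU)` is `ε`-close to `GK`. -/
def IsApproxIso {V : Type*} {n : ℕ} (GU : SimpleGraph V) (GK : SimpleGraph (Fin n)) (ε : ℝ)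
    (out : V → Option (Fin n)) : Prop :=
  ∃ g : V ≃ Fin n, (∀ v, out v = some (g v)) ∧
    (adjDist (GU.map g) GK : ℝ) < ε * (n : ℝ) ^ 2

end Congest

/-! Draw `m = O(ε⁻¹ log n)` nodes independently and uniformly, and label every node by its
adjacencies to this sample. With high probability any two nodes with the same label are near-twins:
their neighbourhoods differ in at most `(ε / 5) n` places (`card_bad_sample_le`). Suppose that a
tuple `η` of nodes of `GK` induces a labelling with the same class sizes and the same edge counts
between classes. Then every label-preserving bijection `g` is good (`adjDist_le_of_weight_eq`): the
bipartite graph between two classes is close to empty or complete in an averaged sense, so two such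
graphs with equally many edges differ little. A suitable `η` exists, as an isomorphism carries the
sample of `GU` to one.

To find `η`, the nodes need the counts of `GU`, but there are exponentially many labels. Only the
counts of the at most `n ^ m` labellings of `GK` can occur, however, and by the probabilistic method
`k = O(m log n)` sets of labels and label pairs suffice for the total counts over these sets to tell
them apart (`exists_separating`). The sets depend on `GK` alone, so all nodes agree on them without
communication. The `k` totals are sums of locally known contributions; pipelining collects and
broadcasts them over a breadth-first tree in `O(D + k)` rounds.

All randomness comes from the root of this tree, which broadcasts `m` random numbers after the nodes
have been numbered in preorder. For the bijection, the members of each class are ranked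
(`exists_ranking`), and the node of rank `i` takes the `i`-th element of the class of `GK` with the
same label. Since `D` is also the diameter of `GK`, the nodes know it and can schedule all phases.
-/

namespace Congest

-- Composition of distributed computations

universe u

/-- A family of maps, one for each network, from inputs at the nodes to outputs at the nodes. -/
abbrev NetFun (X Y : Type) : Type (u + 1) :=
  ∀ ⦃V : Type u⦄ ⦃G : SimpleGraph V⦄, PortNumbering G → (V → X) → V → Y

namespace PortNumbering

variable {V : Type*} {G : SimpleGraph V} (P : PortNumbering G)

/-- The neighbour of `v` behind its port `p`. -/
def peer (v : V) (p : Fin (P.deg v)) : V := (P.nbr v p).1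

/-- The port of `P.peer v p` which leads back to `v`. -/
def back (v : V) (p : Fin (P.deg v)) : Fin (P.deg (P.peer v p)) :=
  (P.nbr (P.peer v p)).symm ⟨v, (P.nbr v p).2.symm⟩

/-- What `v` receives through its port `p`, for messages in an arbitrary type. -/
def recv {α : Type*} (sent : ∀ u, Fin (P.deg u) → α) (v : V) (p : Fin (P.deg v)) : α :=
  sent (P.peer v p) (P.back v p)

theorem adj_peer (v : V) (p : Fin (P.deg v)) : G.Adj v (P.peer v p) := (P.nbr v p).2

theorem peer_back (v : V) (p : Fin (P.deg v)) : P.peer (P.peer v p) (P.back v p) = v := by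
  change ((P.nbr (P.peer v p)) ((P.nbr (P.peer v p)).symm _)).1 = v
  rw [Equiv.apply_symm_apply]

theorem exists_peer {v w : V} (h : G.Adj v w) : ∃ p, P.peer v p = w :=
  ⟨(P.nbr v).symm ⟨w, h⟩, by simp [PortNumbering.peer]⟩

theorem peer_injective (v : V) : Function.Injective (P.peer v) := fun _ _ h =>
  (P.nbr v).injective (Subtype.ext h)

theorem back_eq_iff (v w : V) (p : Fin (P.deg v)) (q : Fin (P.deg w)) (h : P.peer v p = w) :
    ((P.back v p : ℕ) = q) ↔ P.peer w q = v := by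
  subst h
  constructor
  · intro h
    have : P.back v p = q := Fin.ext h
    rw [← this, peer_back]
  · intro h
    have : P.back v p = q := P.peer_injective _ (by rw [h, peer_back])
    rw [this]

theorem peer_congr {u w : V} (h : u = w) {p : Fin (P.deg u)} {q : Fin (P.deg w)}
    (hpq : (p : ℕ) = q) : P.peer u p = P.peer w q := by
  subst h
  rw [Fin.ext hpq]

theorem eq_of_back_eq {v w : V} {p : Fin (P.deg v)} {q : Fin (P.deg w)}
    (h : P.peer v p = P.peer w q) (hb : (P.back v p : ℕ) = P.back w q) : v = w := by
  rw [← P.peer_back v p, ← P.peer_back w q]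
  exact P.peer_congr h hb

end PortNumbering

/-- The effect of one round. -/
def oneRound {X Y α : Type} (send : (d : ℕ) → X → Fin d → α)
    (step : (d : ℕ) → X → (Fin d → α) → Y) : NetFun.{u} X Y :=
  fun _ _ P x v => step (P.deg v) (x v) (P.recv (fun u => send (P.deg u) (x u)) v)

/-- `Realizable b T F`: in every network, `T` rounds with `b`-bit messages suffice to pass from the
inputs `x` of the nodes to the outputs `F P x`. -/
inductive Realizable (b : ℕ) : ∀ {X Y : Type}, ℕ → NetFun.{u} X Y → Prop
  | loc {X Y : Type} (f : ℕ → X → Y) : Realizable b 0 (fun _ _ P x v => f (P.deg v) (x v))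
  | round {X Y Z α : Type} [Finite α] [Nonempty α] (hα : Nat.card α ≤ 2 ^ b)
      (send : (d : ℕ) → X → Fin d → α) (step : (d : ℕ) → X → (Fin d → α) → Y) {T : ℕ}
      {F : NetFun.{u} Y Z} (hF : Realizable b T F) :
      Realizable b (T + 1) (fun _ _ P x => F P (oneRound send step P x))

/-- The states after `t` rounds of a machine with time-independent rules. -/
def runMachine {V : Type*} {G : SimpleGraph V} {b : ℕ} {S : Type} (P : PortNumbering G)
    (send : (d : ℕ) → S → Fin d → Msg b) (step : (d : ℕ) → S → (Fin d → Msg b) → S)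
    (s : V → S) : ℕ → V → S
  | 0 => s
  | t + 1 => fun v => step (P.deg v) (runMachine P send step s t v)
      (P.received (fun u => send (P.deg u) (runMachine P send step s t u)) v)

theorem runMachine_succ' {V : Type*} {G : SimpleGraph V} {b : ℕ} {S : Type} (P : PortNumbering G)
    (send : (d : ℕ) → S → Fin d → Msg b) (step : (d : ℕ) → S → (Fin d → Msg b) → S)
    (s : V → S) (t : ℕ) :
    runMachine P send step s (t + 1) =
      runMachine P send step (runMachine P send step s 1) t := by
  induction t with
  | zero => rfl
  | succ t ih => rw [runMachine, ih]; rfl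

namespace Realizable

variable {b : ℕ} {X Y Z : Type}

/-- The rules of an `Algorithm` do not depend on time, so the state must tell which round it is.
Each `round` adds a summand to the state type: the left summand holds the states before that round,
the right one those of the remaining machine. -/
theorem exists_machine {T : ℕ} {F : NetFun.{u} X Y} (h : Realizable b T F) :
    ∃ (S : Type) (init : ℕ → X → S) (send : (d : ℕ) → S → Fin d → Msg b)
      (step : (d : ℕ) → S → (Fin d → Msg b) → S) (out : S → Y),
      ∀ (V : Type u) (G : SimpleGraph V) (P : PortNumbering G) (x : V → X) (v : V),
        out (runMachine P send step (fun u => init (P.deg u) (x u)) T v) = F P x v := by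
  induction h with
  | @loc X Y f =>
    exact ⟨Y, f, fun _ _ _ _ => false, fun _ s _ => s, id, fun V G P x v => rfl⟩
  | @round X Y Z α _ _ hα snd stp T F _ ih =>
    obtain ⟨S, init, send, step, out, hS⟩ := ih
    obtain ⟨e⟩ : Nonempty (α ↪ Msg b) := by
      have := Fintype.ofFinite α
      apply Function.Embedding.nonempty_of_card_le
      simpa [Nat.card_eq_fintype_card] using hα
    have hinv : ∀ a, Function.invFun e (e a) = a := Function.leftInverse_invFun e.injective
    refine ⟨X ⊕ S, fun _ => Sum.inl,
      fun d s => s.elim (fun x p => e (snd d x p)) (fun s => send d s),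
      fun d s μ => s.elim
        (fun x => Sum.inr (init d (stp d x (fun p => Function.invFun e (μ p)))))
        (fun s => Sum.inr (step d s μ)),
      -- No state is in the left summand at the end; the value there only has to be some element of
      -- `Z`.
      fun s => s.elim (fun x => out (init 0 (stp 0 x Fin.elim0))) out, fun V G P x v => ?_⟩
    rw [runMachine_succ']
    change _ = F P (oneRound snd stp P x) v
    rw [← hS]
    have key : ∀ (s : V → S) (t : ℕ),
        runMachine P (fun d s => s.elim (fun x p => e (snd d x p)) (fun s => send d s))
          (fun d s μ => s.elim
            (fun x => Sum.inr (init d (stp d x (fun p => Function.invFun e (μ p)))))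
            (fun s => Sum.inr (step d s μ))) (fun v => (Sum.inr (s v) : X ⊕ S)) t =
          fun v => Sum.inr (runMachine P send step s t v) := by
      intro s t
      induction t with
      | zero => rfl
      | succ t ih => rw [runMachine, ih]; rfl
    have h1 : runMachine P (fun d s => s.elim (fun x p => e (snd d x p)) (fun s => send d s))
          (fun d s μ => s.elim
            (fun x => Sum.inr (init d (stp d x (fun p => Function.invFun e (μ p)))))
            (fun s => Sum.inr (step d s μ))) (fun v => (Sum.inl (x v) : X ⊕ S)) 1 =
          fun v => Sum.inr (init (P.deg v) (oneRound snd stp P x v)) := by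
      funext v
      simp only [runMachine, Sum.elim_inl, PortNumbering.received, hinv]
      rfl
    rw [h1, key]
    rfl

/-- A realizable map with the identifiers and seeds as inputs gives an algorithm. -/
theorem exists_algorithm {Seed Out : Type} [Finite Seed] [Nonempty Seed] {T : ℕ}
    {F : NetFun.{u} (ℕ × Seed) (Option Out)} (h : Realizable b T F) :
    ∃ A : Algorithm b Out, A.rounds = T ∧
      ∀ (V : Type u) (G : SimpleGraph V) (P : PortNumbering G) (ident : V → ℕ)
        (E : (V → Option Out) → Prop),
        A.prob P ident E = ({ω : V → Seed | E (F P (fun v => (ident v, ω v)))}.ncard : ℝ) /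
          (Nat.card (V → Seed) : ℝ) := by
  obtain ⟨S, init, send, step, out, hS⟩ := h.exists_machine
  refine ⟨⟨S, Seed, inferInstance, inferInstance, fun i d s => init d (i, s), send, step, T, out⟩,
    rfl, fun V G P ident E => ?_⟩
  have : ∀ ω : V → Seed, Algorithm.result (b := b) (Out := Out)
      ⟨S, Seed, inferInstance, inferInstance, fun i d s => init d (i, s), send, step, T, out⟩
      P ident ω = F P (fun v => (ident v, ω v)) := by
    intro ω
    funext v
    rw [← hS, Algorithm.result]
    congr 1
    have : ∀ t, Algorithm.stateAt (b := b) (Out := Out)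
        ⟨S, Seed, inferInstance, inferInstance, fun i d s => init d (i, s), send, step, T, out⟩
        P ident ω t = runMachine P send step (fun u => init (P.deg u) (ident u, ω u)) t := by
      intro t
      induction t with
      | zero => rfl
      | succ t ih => funext v; simp only [Algorithm.stateAt, runMachine, ih]
    exact congrFun (this T) v
  rw [Algorithm.prob]
  simp only [this]

/-- Local computation merges into the first round (or into the output), so it costs no round. -/
theorem precomp (f : ℕ → X → Y) {T : ℕ} {F : NetFun.{u} Y Z} (h : Realizable b T F) :
    Realizable b T (fun _ _ P x => F P (fun v => f (P.deg v) (x v)) : NetFun.{u} X Z) := by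
  cases h with
  | loc g => exact loc (fun d x => g d (f d x))
  | round hα snd stp hF =>
    exact round hα (fun d x => snd d (f d x)) (fun d x => stp d (f d x)) hF

theorem comp {T T' : ℕ} {F : NetFun.{u} X Y} {F' : NetFun.{u} Y Z} (h : Realizable b T F)
    (h' : Realizable b T' F') :
    Realizable b (T + T') (fun _ _ P x => F' P (F P x)) := by
  induction h with
  | loc f => simpa using h'.precomp f
  | round hα snd stp hF ih =>
    rw [add_right_comm]
    exact round hα snd stp (ih h')

/-- The nodes may remember their inputs while they compute. -/
theorem remember {W : Type} (f : W → X) {T : ℕ} {F : NetFun.{u} X Y} (h : Realizable b T F) :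
    Realizable b T (fun _ _ P w v => (w v, F P (fun u => f (w u)) v) : NetFun.{u} W (W × Y)) := by
  induction h generalizing W with
  | loc g => exact loc (fun d w => (w, g d (f w)))
  | round hα snd stp hF ih =>
    have := round hα (fun d (w : W) => snd d (f w)) (fun d w μ => (w, stp d (f w) μ))
      ((ih Prod.snd).comp (loc fun _ y => (y.1.1, y.2)))
    exact this

/-- After the computation of `q`, the nodes compute `F` from it, and keep both. -/
theorem extend {W : Type} {T T' : ℕ} {q : NetFun.{u} W Y} (hq : Realizable b T q) (f : Y → X)
    {F : NetFun.{u} X Z} (hF : Realizable b T' F) :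
    Realizable b (T + T')
      (fun _ _ P w v => (q P w v, F P (fun u => f (q P w u)) v) : NetFun.{u} W (Y × Z)) :=
  hq.comp (hF.remember f)

theorem map {W : Type} {T : ℕ} {q : NetFun.{u} W Y} (hq : Realizable b T q) (f : ℕ → Y → Z) :
    Realizable b T (fun _ _ P w v => f (P.deg v) (q P w v) : NetFun.{u} W Z) :=
  hq.comp (loc f)

end Realizable

/-- The states after `T` rounds with the same kind of messages and time-dependent rules. -/
def iterRounds {S α : Type} (send : ℕ → (d : ℕ) → S → Fin d → α)
    (step : ℕ → (d : ℕ) → S → (Fin d → α) → S) : ℕ → NetFun.{u} S S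
  | 0 => fun _ _ _ x => x
  | t + 1 => fun _ _ P x => oneRound (send t) (step t) P (iterRounds send step t P x)

theorem realizable_iterRounds {b : ℕ} {S α : Type} [Finite α] [Nonempty α]
    (hα : Nat.card α ≤ 2 ^ b) (send : ℕ → (d : ℕ) → S → Fin d → α)
    (step : ℕ → (d : ℕ) → S → (Fin d → α) → S) (T : ℕ) :
    Realizable b T (iterRounds.{u} send step T) := by
  induction T with
  | zero => exact Realizable.loc (fun _ x => x)
  | succ T ih => exact ih.comp (Realizable.round hα (send T) (step T) (Realizable.loc fun _ x => x))

/-! ### Rooted spanning trees and sums over subtrees -/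

/-- `tr` describes a spanning tree with root `r` and height at most `D`: the first component is the
depth of a node, the second one its port which leads to its parent. -/
structure IsTree {V : Type*} {G : SimpleGraph V} (P : PortNumbering G) (tr : V → ℕ × ℕ) (r : V)
    (D : ℕ) : Prop where
  root : (tr r).1 = 0
  parent : ∀ v, v ≠ r → ∃ p : Fin (P.deg v), (tr v).2 = p ∧ (tr (P.peer v p)).1 + 1 = (tr v).1
  le : ∀ v, (tr v).1 ≤ D

/-- A node with tree data `τ` has a parent, behind its port `p`. -/
def IsUp (τ : ℕ × ℕ) (p : ℕ) : Prop := τ.1 ≠ 0 ∧ τ.2 = p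

instance (τ : ℕ × ℕ) (p : ℕ) : Decidable (IsUp τ p) := inferInstanceAs (Decidable (_ ∧ _))

/-- The neighbour of `v` behind the port `q` is a child of `v`. -/
def IsChild {V : Type*} {G : SimpleGraph V} (P : PortNumbering G) (tr : V → ℕ × ℕ) (v : V)
    (q : Fin (P.deg v)) : Prop :=
  IsUp (tr (P.peer v q)) (P.back v q)

instance {V : Type*} {G : SimpleGraph V} (P : PortNumbering G) (tr : V → ℕ × ℕ) (v : V)
    (q : Fin (P.deg v)) : Decidable (IsChild P tr v q) := inferInstanceAs (Decidable (IsUp _ _))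

namespace IsTree

variable {V : Type*} {G : SimpleGraph V} {P : PortNumbering G} {tr : V → ℕ × ℕ} {r : V} {D : ℕ}

theorem depth_eq_zero (h : IsTree P tr r D) {v : V} : (tr v).1 = 0 ↔ v = r := by
  constructor
  · intro hv
    by_contra hne
    obtain ⟨p, -, hp⟩ := h.parent v hne
    omega
  · rintro rfl
    exact h.root

theorem depth_child (h : IsTree P tr r D) {v : V} {q : Fin (P.deg v)} (hq : IsChild P tr v q) :
    (tr (P.peer v q)).1 = (tr v).1 + 1 := by
  obtain ⟨p, hp, hd⟩ := h.parent _ (fun e => hq.1 (h.depth_eq_zero.2 e))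
  have : p = P.back v q := Fin.ext (hp.symm.trans hq.2)
  subst this
  rw [P.peer_back] at hd
  exact hd.symm

/-- The sum over the children of all nodes of depth `d` is the sum over the nodes of depth
`d + 1`. -/
theorem sum_children [Fintype V] {M : Type*} [AddCommMonoid M] (h : IsTree P tr r D) (d : ℕ)
    (a : V → M) :
    (∑ v with (tr v).1 = d, ∑ q : Fin (P.deg v), if IsChild P tr v q then a (P.peer v q) else 0) =
      ∑ u with (tr u).1 = d + 1, a u := by
  classical
  simp_rw [← Finset.sum_filter]
  rw [Finset.sum_sigma']
  refine Finset.sum_bij (fun x _ => P.peer x.1 x.2) ?_ ?_ ?_ ?_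
  · rintro ⟨v, q⟩ hx
    simp only [Finset.mem_sigma, Finset.mem_filter, Finset.mem_univ, true_and] at hx ⊢
    rw [h.depth_child hx.2, hx.1]
  · rintro ⟨v, q⟩ hx ⟨v', q'⟩ hx' heq
    simp only [Finset.mem_sigma, Finset.mem_filter, Finset.mem_univ, true_and] at hx hx' heq
    have h2 : v = v' := P.eq_of_back_eq heq (by rw [← hx.2.2, heq, hx'.2.2])
    subst h2
    rw [P.peer_injective v heq]
  · intro u hu
    simp only [Finset.mem_filter, Finset.mem_univ, true_and] at hu
    obtain ⟨p, hp, hd⟩ := h.parent u (fun e => by rw [h.depth_eq_zero.2 e] at hu; omega)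
    refine ⟨⟨P.peer u p, P.back u p⟩, ?_, P.peer_back u p⟩
    simp only [Finset.mem_sigma, Finset.mem_filter, Finset.mem_univ, true_and]
    refine ⟨by omega, ?_⟩
    have : ((P.back (P.peer u p) (P.back u p) : Fin _) : ℕ) = p :=
      (P.back_eq_iff _ u _ p (P.peer_back u p)).2 rfl
    exact ⟨by rw [P.peer_back]; omega, by rw [this, P.peer_back]; exact hp⟩
  · intros; rfl

/-- Induction on `i`, which moves `d` upwards from the empty level `D + 1`: the children of level
`d` make up level `d + 1`. -/
theorem sum_level_eq [Fintype V] (h : IsTree P tr r D) {a x : V → ℕ}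
    (ha : ∀ v, a v = x v + ∑ q, if IsChild P tr v q then a (P.peer v q) else 0) (i d : ℕ)
    (hd : d + i = D + 1) :
    ∑ v with (tr v).1 = d, a v = ∑ v with d ≤ (tr v).1, x v := by
  classical
  induction i generalizing d with
  | zero =>
    rw [Finset.sum_eq_zero, Finset.sum_eq_zero] <;>
    · intro v hv
      have := h.le v
      simp at hv
      omega
  | succ i ih =>
    rw [Finset.sum_congr rfl (fun v _ => ha v), Finset.sum_add_distrib, h.sum_children,
      ih (d + 1) (by omega), ← Finset.sum_union]
    · congr 1
      ext v
      simp
      omega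
    · rw [Finset.disjoint_filter]
      omega

/-- The one-sided version bounds the partial sums before it is known that no overflow occurs. -/
theorem sum_level_le [Fintype V] (h : IsTree P tr r D) {a x : V → ℕ}
    (ha : ∀ v, a v ≤ x v + ∑ q, if IsChild P tr v q then a (P.peer v q) else 0) (i d : ℕ)
    (hd : d + i = D + 1) :
    ∑ v with (tr v).1 = d, a v ≤ ∑ v with d ≤ (tr v).1, x v := by
  classical
  induction i generalizing d with
  | zero =>
    rw [Finset.sum_eq_zero]
    · exact Nat.zero_le _
    · intro v hv
      have := h.le v
      simp at hv
      omega
  | succ i ih =>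
    refine (Finset.sum_le_sum (fun v _ => ha v)).trans ?_
    rw [Finset.sum_add_distrib, h.sum_children]
    refine (Nat.add_le_add_left (ih (d + 1) (by omega)) _).trans (le_of_eq ?_)
    rw [← Finset.sum_union]
    · congr 1
      ext v
      simp
      omega
    · rw [Finset.disjoint_filter]
      omega

/-- If the sums over subtrees are computed up to overflow, and the total sum is so small that no
overflow occurs, then they are exact. -/
theorem subtree_sum [Fintype V] (h : IsTree P tr r D) {a x : V → ℕ} {N : ℕ}
    (ha : ∀ v, a v = x v + ∑ q, if IsChild P tr v q then a (P.peer v q) % N else 0)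
    (hN : ∑ v, x v < N) :
    (∀ v, a v = x v + ∑ q, if IsChild P tr v q then a (P.peer v q) else 0) ∧
      (∀ v, a v ≤ ∑ v, x v) ∧ a r = ∑ v, x v := by
  -- Reduction modulo `N` only decreases the values, so all of them are at most the total, which is
  -- less than `N`. Hence the reduction does nothing.
  have hle : ∀ v, a v ≤ x v + ∑ q, if IsChild P tr v q then a (P.peer v q) else 0 := by
    intro v
    rw [ha v]
    gcongr with q
    split_ifs
    · exact Nat.mod_le _ _
    · rfl
  have hle' : ∀ v, a v ≤ ∑ v, x v := by
    intro v
    calc a v ≤ ∑ w with (tr w).1 = (tr v).1, a w :=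
          Finset.single_le_sum (f := a) (fun _ _ => Nat.zero_le _) (by simp)
      _ ≤ ∑ w with (tr v).1 ≤ (tr w).1, x w :=
          h.sum_level_le hle (D + 1 - (tr v).1) _ (by have := h.le v; omega)
      _ ≤ _ := Finset.sum_le_sum_of_subset (Finset.filter_subset _ _)
  have heq : ∀ v, a v = x v + ∑ q, if IsChild P tr v q then a (P.peer v q) else 0 := by
    intro v
    rw [ha v]
    simp_rw [Nat.mod_eq_of_lt ((hle' _).trans_lt hN)]
  refine ⟨heq, hle', ?_⟩
  have := h.sum_level_eq heq (D + 1) 0 (by omega)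
  have hr : (Finset.univ.filter fun v => (tr v).1 = 0) = {r} := by
    ext v
    simp [h.depth_eq_zero]
  rw [hr] at this
  simpa using this

end IsTree

/-! ### Election of a root and a breadth-first search tree -/

open Classical in
/-- A node which hears of a smaller key adopts it, and records the time and the port. -/
noncomputable def electStep {α : Type} [LinearOrder α] (t d : ℕ) (s : α × ℕ × ℕ) (μ : Fin d → α) :
    α × ℕ × ℕ :=
  if h : ∃ p, μ p < s.1 ∧ ∀ q, μ p ≤ μ q then (μ h.choose, t + 1, h.choose) else s

/-- The smallest key is flooded for `T` rounds. -/
noncomputable def elect {α : Type} [LinearOrder α] (T : ℕ) : NetFun.{u} α (ℕ × ℕ) :=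
  fun _ _ P x v =>
    (iterRounds (fun _ _ s _ => s.1) electStep T P (fun v => (x v, 0, 0)) v).2

theorem realizable_elect {α : Type} [LinearOrder α] [Finite α] [Nonempty α] {b : ℕ}
    (hα : Nat.card α ≤ 2 ^ b) (T : ℕ) : Realizable b T (elect.{u} (α := α) T) :=
  ((realizable_iterRounds hα _ _ T).precomp (fun _ x => (x, 0, 0))).map (fun _ s => s.2)

/-- After `t` rounds exactly the nodes within distance `t` of `r` hold the key of `r`, and they
never change again. So the last adoption of a node happens in round `G.dist r v`, through a port
towards `r`. -/
theorem isTree_elect {α : Type} [LinearOrder α] {V : Type u} {G : SimpleGraph V}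
    (P : PortNumbering G) (hG : G.Connected) (x : V → α) (r : V) (hr : ∀ v, v ≠ r → x r < x v)
    (T : ℕ) (hT : ∀ v, G.dist r v ≤ T) : IsTree P (elect T P x) r T := by
  have key : ∀ t v,
      (G.dist r v ≤ t →
        (iterRounds (fun _ _ s _ => s.1) electStep t P (fun v => (x v, 0, 0)) v).1 = x r ∧
        (iterRounds (fun _ _ s _ => s.1) electStep t P (fun v => (x v, 0, 0)) v).2.1 =
          G.dist r v ∧
        (v ≠ r → ∃ p : Fin (P.deg v),
          (iterRounds (fun _ _ s _ => s.1) electStep t P (fun v => (x v, 0, 0)) v).2.2 = p ∧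
          G.dist r (P.peer v p) + 1 = G.dist r v)) ∧
      (t < G.dist r v →
        x r < (iterRounds (fun _ _ s _ => s.1) electStep t P (fun v => (x v, 0, 0)) v).1) := by
    intro t
    induction t with
    | zero =>
      intro v
      refine ⟨fun h => ?_, fun h => hr v ?_⟩
      · have : r = v := (hG.dist_eq_zero_iff).1 (by omega)
        subst this
        exact ⟨rfl, by simp [iterRounds], fun h => absurd rfl h⟩
      · rintro rfl
        simp at h
    | succ t ih =>
      intro v
      set s := iterRounds (fun _ _ s _ => s.1) electStep t P (fun v => (x v, 0, 0)) with hs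
      have hstep : iterRounds (fun _ _ s _ => s.1) electStep (t + 1) P (fun v => (x v, 0, 0)) v =
          electStep t (P.deg v) (s v) (fun p => (s (P.peer v p)).1) := rfl
      rw [hstep]
      have hmin : ∀ w, x r ≤ (s w).1 := by
        intro w
        rcases le_or_gt (G.dist r w) t with h | h
        · exact (((ih w).1 h).1).ge
        · exact ((ih w).2 h).le
      rcases le_or_gt (G.dist r v) t with h | h
      · obtain ⟨h1, h2, h3⟩ := (ih v).1 h
        have : electStep t (P.deg v) (s v) (fun p => (s (P.peer v p)).1) = s v := by
          rw [electStep, dif_neg]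
          rintro ⟨p, hp, -⟩
          rw [h1] at hp
          exact absurd hp (hmin _).not_gt
        rw [this]
        exact ⟨fun _ => ⟨h1, h2, h3⟩, fun h' => by omega⟩
      · have hlt := (ih v).2 h
        rcases Nat.lt_or_ge (t + 1) (G.dist r v) with h' | h'
        · refine ⟨fun h'' => by omega, fun _ => ?_⟩
          rw [electStep]
          split_ifs with hc
          · refine (ih _).2 ?_
            have := hG.dist_triangle (u := r) (v := P.peer v hc.choose) (w := v)
            have h1 : G.dist (P.peer v hc.choose) v = 1 :=
              SimpleGraph.dist_eq_one_iff_adj.2 (P.adj_peer _ _).symm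
            omega
          · exact hlt
        · refine ⟨fun _ => ?_, fun h'' => by omega⟩
          have hd : G.dist r v = t + 1 := by omega
          obtain ⟨w, hw, hwd⟩ : ∃ w, G.Adj w v ∧ G.dist r w = t := by
            obtain ⟨p, hp⟩ := hG.exists_walk_length_eq_dist v r
            rw [SimpleGraph.dist_comm, hd] at hp
            cases p with
            | nil => simp at hp
            | @cons _ w _ ha p =>
              refine ⟨w, ha.symm, ?_⟩
              simp at hp
              have h1 := SimpleGraph.dist_le p
              rw [SimpleGraph.dist_comm, hp] at h1
              have := hG.dist_triangle (u := r) (v := w) (w := v)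
              have h2 : G.dist w v = 1 := SimpleGraph.dist_eq_one_iff_adj.2 ha.symm
              omega
          obtain ⟨p, rfl⟩ := P.exists_peer hw.symm
          have hsp : (s (P.peer v p)).1 = x r := ((ih _).1 hwd.le).1
          have hc : ∃ p, (s (P.peer v p)).1 < (s v).1 ∧
              ∀ q, (s (P.peer v p)).1 ≤ (s (P.peer v q)).1 :=
            ⟨p, hsp ▸ hlt, fun q => hsp ▸ hmin _⟩
          rw [electStep, dif_pos hc]
          have h1 : (s (P.peer v hc.choose)).1 = x r :=
            le_antisymm (hsp ▸ hc.choose_spec.2 p) (hmin _)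
          refine ⟨h1, hd.symm, fun _ => ⟨hc.choose, rfl, ?_⟩⟩
          have h2 : ¬ t < G.dist r (P.peer v hc.choose) := fun hlt' =>
            ((ih _).2 hlt').ne' h1
          have := hG.dist_triangle (u := r) (v := P.peer v hc.choose) (w := v)
          have h3 : G.dist (P.peer v hc.choose) v = 1 :=
            SimpleGraph.dist_eq_one_iff_adj.2 (P.adj_peer _ _).symm
          omega
  have hdist : ∀ v, (elect T P x v).1 = G.dist r v := fun v => ((key T v).1 (hT v)).2.1
  refine ⟨by simp [hdist], fun v hv => ?_, fun v => by rw [hdist]; exact hT v⟩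
  obtain ⟨p, hp, hpd⟩ := ((key T v).1 (hT v)).2.2 hv
  exact ⟨p, hp, by rw [hdist, hdist, hpd]⟩

/-! ### Pipelined sums towards the root -/

/-- In round `t` a node of depth `i` sends item `t + i - D` to its parent. -/
def upSend (N D : ℕ) [NeZero N] (t d : ℕ) (s : (ℕ × ℕ) × (ℕ → ℕ)) (p : Fin d) : Fin N :=
  if IsUp s.1 p ∧ D ≤ t + s.1.1 then Fin.ofNat N (s.2 (t + s.1.1 - D)) else 0

/-- A node adds what its children send to the corresponding item. -/
def upStep (N D : ℕ) (t d : ℕ) (s : (ℕ × ℕ) × (ℕ → ℕ)) (μ : Fin d → Fin N) :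
    (ℕ × ℕ) × (ℕ → ℕ) :=
  (s.1, fun j => if j + D = t + s.1.1 + 1 then s.2 j + ∑ q, (μ q : ℕ) else s.2 j)

/-- The sums over the subtrees of the items at the nodes (up to overflow). -/
def upSum (N D T : ℕ) [NeZero N] : NetFun.{u} ((ℕ × ℕ) × (ℕ → ℕ)) (ℕ → ℕ) :=
  fun _ _ P x v => (iterRounds (upSend N D) (upStep N D) T P x v).2

theorem realizable_upSum {N b : ℕ} [NeZero N] (hN : N ≤ 2 ^ b) (D T : ℕ) :
    Realizable b T (upSum.{u} N D T) :=
  (realizable_iterRounds (α := Fin N) (by simpa using hN) (upSend N D) (upStep N D) T).map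
    (fun _ s => s.2)

/-- Item `j` of a node of depth `i` changes only in round `j + D - i - 1`. In that round its
children, of depth `i + 1`, send exactly item `j`, which is final for them since the previous round.
-/
theorem upSum_eq {V : Type u} {G : SimpleGraph V} {P : PortNumbering G} {tr : V → ℕ × ℕ} {r : V}
    {D : ℕ} (hT : IsTree P tr r D) (N T : ℕ) [NeZero N] (x : V → ℕ → ℕ) (v : V) (j : ℕ)
    (hj : j + D ≤ T) :
    upSum N D T P (fun v => (tr v, x v)) v j = x v j +
      ∑ q, if IsChild P tr v q then
        upSum N D T P (fun v => (tr v, x v)) (P.peer v q) j % N else 0 := by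
  set S := fun t => iterRounds (upSend N D) (upStep N D) t P (fun v => (tr v, x v)) with hS
  have hfst : ∀ t v, (S t v).1 = tr v := by
    intro t v
    induction t with
    | zero => rfl
    | succ t ih => exact ih
  have hstep : ∀ t v j, (S (t + 1) v).2 j = if j + D = t + (tr v).1 + 1 then
      (S t v).2 j + ∑ q, (upSend N D t _ (S t (P.peer v q)) (P.back v q) : ℕ)
      else (S t v).2 j := by
    intro t v j
    change (if j + D = t + (S t v).1.1 + 1 then _ else _) = _
    rw [hfst]
    rfl
  have hbefore : ∀ t v j, t + (tr v).1 < j + D → (S t v).2 j = x v j := by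
    intro t v j h
    induction t with
    | zero => rfl
    | succ t ih => rw [hstep, if_neg (by omega), ih (by omega)]
  have hafter : ∀ t t' v j, j + D ≤ t + (tr v).1 → t ≤ t' → (S t' v).2 j = (S t v).2 j := by
    intro t t' v j h htt'
    induction t', htt' using Nat.le_induction with
    | base => rfl
    | succ t' _ ih => rw [hstep, if_neg (by omega), ih]
  change (S T v).2 j = x v j + ∑ q, if IsChild P tr v q then (S T (P.peer v q)).2 j % N else 0
  have hD := hT.le v
  -- In this case `j = 0` and `v` has depth `D`, hence no children.
  by_cases h0 : j + D ≤ (tr v).1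
  · rw [hafter 0 T v j (by omega) (Nat.zero_le _), Finset.sum_eq_zero]
    · rfl
    · intro q _
      rw [if_neg]
      intro hc
      have := hT.depth_child hc
      have := hT.le (P.peer v q)
      omega
  · obtain ⟨t, ht⟩ : ∃ t, j + D = t + (tr v).1 + 1 := ⟨j + D - (tr v).1 - 1, by omega⟩
    rw [hafter (t + 1) T v j (by omega) (by omega), hstep, if_pos ht, hbefore t v j (by omega)]
    congr 1
    refine Finset.sum_congr rfl fun q _ => ?_
    rw [upSend, hfst]
    by_cases hc : IsChild P tr v q
    · have hd := hT.depth_child hc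
      rw [if_pos hc, if_pos ⟨hc, by omega⟩, hafter t T _ j (by omega) (by omega)]
      have : t + (tr (P.peer v q)).1 - D = j := by omega
      rw [this]
      rfl
    · rw [if_neg hc, if_neg (fun h => hc h.1)]
      rfl

/-- The root learns the exact sums when there is no overflow. -/
theorem upSum_root {V : Type u} [Fintype V] {G : SimpleGraph V} {P : PortNumbering G}
    {tr : V → ℕ × ℕ} {r : V} {D : ℕ} (hT : IsTree P tr r D) (N T : ℕ) [NeZero N] (x : V → ℕ → ℕ)
    (j : ℕ) (hj : j + D ≤ T) (hN : ∑ v, x v j < N) :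
    upSum N D T P (fun v => (tr v, x v)) r j = ∑ v, x v j :=
  (hT.subtree_sum (a := fun v => upSum N D T P (fun v => (tr v, x v)) v j)
    (fun v => upSum_eq hT N T x v j hj) hN).2.2

/-! ### Pipelined distribution from the root -/

section Down

variable {β C : Type} [Inhabited β]

/-- In round `t` a node of depth `i` sends item `t - i` to its children. -/
def downSend (φ : C → ℕ → β → β) (t d : ℕ) (s : (ℕ × ℕ) × C × (ℕ → β)) (p : Fin d) : β :=
  if s.1.1 ≤ t then φ s.2.1 p (s.2.2 (t - s.1.1)) else default

/-- A node stores what its parent sends. -/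
def downStep (t d : ℕ) (s : (ℕ × ℕ) × C × (ℕ → β)) (μ : Fin d → β) : (ℕ × ℕ) × C × (ℕ → β) :=
  (s.1, s.2.1, fun j => if h : s.1.2 < d ∧ s.1.1 ≠ 0 ∧ j + s.1.1 = t + 1 then μ ⟨s.1.2, h.1⟩
    else s.2.2 j)

/-- Items are passed from the root down the tree; a node with data `c` passes the item `y` through
its port `p` as `φ c p y`. -/
def passDown (φ : C → ℕ → β → β) (T : ℕ) : NetFun.{u} ((ℕ × ℕ) × C × (ℕ → β)) (ℕ → β) :=
  fun _ _ P x v => (iterRounds (downSend φ) downStep T P x v).2.2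

theorem realizable_passDown [Finite β] {b : ℕ} (hβ : Nat.card β ≤ 2 ^ b) (φ : C → ℕ → β → β)
    (T : ℕ) : Realizable b T (passDown.{u} φ T) :=
  (realizable_iterRounds hβ (downSend φ) downStep T).map (fun _ s => s.2.2)

variable {V : Type u} {G : SimpleGraph V} {P : PortNumbering G} {tr : V → ℕ × ℕ} {r : V} {D : ℕ}

theorem passDown_root (hT : IsTree P tr r D) (φ : C → ℕ → β → β) (T : ℕ) (c : V → C)
    (x : V → ℕ → β) : passDown φ T P (fun v => (tr v, c v, x v)) r = x r := by
  have : ∀ t, (iterRounds (downSend φ) downStep t P (fun v => (tr v, c v, x v)) r) =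
      (tr r, c r, x r) := by
    intro t
    induction t with
    | zero => rfl
    | succ t ih =>
      change downStep t _ (iterRounds (downSend φ) downStep t P _ r) _ = _
      rw [ih]
      simp [downStep, hT.root]
  rw [passDown, this]

/-- Item `j` is final at depth `i` after `j + i` rounds, and is forwarded in the very next round. -/
theorem passDown_eq (hT : IsTree P tr r D) (φ : C → ℕ → β → β) (T : ℕ) (c : V → C)
    (x : V → ℕ → β) (v : V) (q : Fin (P.deg v)) (hq : IsChild P tr v q) (j : ℕ)
    (hj : j + D ≤ T) :
    passDown φ T P (fun v => (tr v, c v, x v)) (P.peer v q) j =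
      φ (c v) q (passDown φ T P (fun v => (tr v, c v, x v)) v j) := by
  set S := fun t => iterRounds (downSend φ) downStep t P (fun v => (tr v, c v, x v)) with hS
  have hfst : ∀ t v, (S t v).1 = tr v ∧ (S t v).2.1 = c v := by
    intro t v
    induction t with
    | zero => exact ⟨rfl, rfl⟩
    | succ t ih => exact ih
  have hstep : ∀ t v j, (S (t + 1) v).2.2 j =
      if h : (tr v).2 < P.deg v ∧ (tr v).1 ≠ 0 ∧ j + (tr v).1 = t + 1 then
        downSend φ t _ (S t (P.peer v ⟨_, h.1⟩)) (P.back v ⟨_, h.1⟩) else (S t v).2.2 j := by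
    intro t v j
    have : ∀ (τ : ℕ × ℕ) (d : ℕ) (s : (ℕ × ℕ) × C × (ℕ → β)) (μ : Fin d → β), s.1 = τ →
        (downStep t d s μ).2.2 j = if h : τ.2 < d ∧ τ.1 ≠ 0 ∧ j + τ.1 = t + 1 then μ ⟨τ.2, h.1⟩
          else s.2.2 j := by
      rintro _ d s μ rfl
      rfl
    exact this _ _ _ _ (hfst t v).1
  have hafter : ∀ t t' v j, j + (tr v).1 ≤ t → t ≤ t' → (S t' v).2.2 j = (S t v).2.2 j := by
    intro t t' v j h htt'
    induction t', htt' using Nat.le_induction with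
    | base => rfl
    | succ t' _ ih => rw [hstep, dif_neg (by omega), ih]
  change (S T _).2.2 j = φ (c v) q ((S T v).2.2 j)
  have hd := hT.depth_child hq
  have hD := hT.le (P.peer v q)
  have hpar : (tr (P.peer v q)).2 = P.back v q := hq.2
  rw [hafter (j + (tr v).1 + 1) T _ j (by omega) (by omega), hstep,
    dif_pos ⟨by rw [hpar]; exact Fin.is_lt _, by omega, by omega⟩]
  have hback : ((P.back (P.peer v q) (P.back v q) : Fin _) : ℕ) = q :=
    (P.back_eq_iff _ _ _ q (P.peer_back v q)).2 rfl
  -- The parent's port is stored as a natural number; a variable `z` avoids rewriting inside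
  -- dependent types.
  have hsend : ∀ z : Fin (P.deg (P.peer v q)), z = P.back v q →
      downSend φ (j + (tr v).1) _ (S (j + (tr v).1) (P.peer (P.peer v q) z))
        (P.back (P.peer v q) z) = φ (c v) q ((S (j + (tr v).1) v).2.2 j) := by
    rintro _ rfl
    simp only [downSend, (hfst _ _).1, (hfst _ _).2, hback, P.peer_back]
    rw [if_pos (by omega), Nat.add_sub_cancel]
  rw [hafter (j + (tr v).1) T v j le_rfl (by omega)]
  exact hsend _ (Fin.ext hpar)

theorem passDown_broadcast (hT : IsTree P tr r D) (T : ℕ) (c : V → C)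
    (x : V → ℕ → β) (v : V) (j : ℕ) (hj : j + D ≤ T) :
    passDown (fun _ _ y => y) T P (fun v => (tr v, c v, x v)) v j = x r j := by
  obtain ⟨i, hi⟩ : ∃ i, (tr v).1 = i := ⟨_, rfl⟩
  induction i generalizing v with
  | zero =>
    rw [hT.depth_eq_zero.1 hi, passDown_root hT]
  | succ i ih =>
    obtain ⟨p, hp, hd⟩ := hT.parent v (fun e => by rw [hT.depth_eq_zero.2 e] at hi; omega)
    have hc : IsChild P tr (P.peer v p) (P.back v p) := by
      rw [IsChild, (P.back_eq_iff _ v _ p (P.peer_back v p)).2 rfl, P.peer_back]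
      exact ⟨by omega, hp⟩
    have := passDown_eq hT (fun (_ : C) _ y => y) T c x _ _ hc j hj
    rw [P.peer_back] at this
    rw [this, ih _ (by omega)]

end Down

/-! ### Exchange of long messages between neighbours -/

/-- Every node sends the word `x p` through its port `p`, one letter per round. -/
def exchange {β : Type} [Inhabited β] (T : ℕ) : NetFun.{u} (ℕ → ℕ → β) (ℕ → ℕ → β) :=
  fun _ _ P x v => (iterRounds (fun t _ (s : (ℕ → ℕ → β) × (ℕ → ℕ → β)) p => s.1 p t)
    (fun t d s μ => (s.1, fun p j => if h : p < d ∧ j = t then μ ⟨p, h.1⟩ else s.2 p j)) T P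
    (fun v => (x v, default)) v).2

theorem realizable_exchange {β : Type} [Inhabited β] [Finite β] {b : ℕ} (hβ : Nat.card β ≤ 2 ^ b)
    (T : ℕ) : Realizable b T (exchange.{u} (β := β) T) :=
  ((realizable_iterRounds hβ _ _ T).precomp (fun _ x => (x, default))).map (fun _ s => s.2)

theorem exchange_eq {β : Type} [Inhabited β] (T : ℕ) {V : Type u} {G : SimpleGraph V}
    (P : PortNumbering G) (x : V → ℕ → ℕ → β) (v : V) (p : Fin (P.deg v)) (j : ℕ) (hj : j < T) :
    exchange T P x v p j = x (P.peer v p) (P.back v p) j := by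
  set S := fun t => iterRounds (fun t _ (s : (ℕ → ℕ → β) × (ℕ → ℕ → β)) p => s.1 p t)
    (fun t d s μ => (s.1, fun p j => if h : p < d ∧ j = t then μ ⟨p, h.1⟩ else s.2 p j)) t P
    (fun v => (x v, default)) with hS
  have hfst : ∀ t v, (S t v).1 = x v := by
    intro t v
    induction t with
    | zero => rfl
    | succ t ih => exact ih
  have hstep : ∀ t, (S (t + 1) v).2 p j =
      if h : (p : ℕ) < P.deg v ∧ j = t then (S t (P.peer v p)).1 (P.back v p) t
        else (S t v).2 p j := fun t => rfl
  change (S T v).2 p j = _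
  induction T, hj using Nat.le_induction with
  | base => rw [hstep, dif_pos ⟨p.2, rfl⟩, hfst]
  | succ t ht ih => rw [hstep, dif_neg (by omega), ih]

/-! ### Numbering of the members of a set of nodes -/

/-- Finds the child whose interval of preorder numbers contains a given number. -/
theorem exists_prefix_sum {d : ℕ} (f : Fin d → ℕ) (r : ℕ) (hr : r < ∑ i, f i) :
    ∃ i, ∑ j with j < i, f j ≤ r ∧ r < ∑ j with j < i, f j + f i := by
  induction d generalizing r with
  | zero => simp at hr
  | succ d ih =>
    rw [Fin.sum_univ_succ] at hr
    by_cases h : r < f 0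
    · exact ⟨0, by simp, by simpa using h⟩
    · obtain ⟨i, h1, h2⟩ := ih (fun i => f i.succ) (r - f 0) (by omega)
      have : ∑ j with j < i.succ, f j = f 0 + ∑ j with j < i, f j.succ := by
        rw [Finset.sum_filter, Finset.sum_filter, Fin.sum_univ_succ]
        simp
      exact ⟨i.succ, by omega, by omega⟩

theorem sum_filter_lt_fin {d : ℕ} (f : ℕ → ℕ) (i : Fin d) :
    ∑ j : Fin d with j < i, f j = ∑ j ∈ Finset.range i, f j := by
  rw [← Fin.sum_univ_eq_sum_range]
  exact Finset.sum_bij' (fun j hj => ⟨j, by simpa using hj⟩) (fun j _ => ⟨j, j.2.trans i.2⟩)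
    (by simp) (fun j _ => by simp [Fin.lt_def, -Fin.val_fin_lt]) (by simp) (by simp) (by simp)

/-- A node whose number is `y` passes the number `y + m + ∑ q < p, s q` to the child behind port
`p`, where `m` says whether it is a member, and `s` are the sizes of its subtrees. -/
def offset (N : ℕ) [NeZero N] (c : ℕ × (ℕ → ℕ)) (p : ℕ) (y : Fin N) : Fin N :=
  Fin.ofNat N (y + c.1 + ∑ q ∈ Finset.range p, c.2 q)

/-- The number of members in the subtree of a node. -/
def subtreeCard (N D : ℕ) [NeZero N] : NetFun.{u} ((ℕ × ℕ) × ℕ) ℕ :=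
  fun _ _ P x v => upSum N D D P (fun v => ((x v).1, fun _ => (x v).2)) v 0

/-- The numbers of members in the subtrees of the children of a node. -/
def childCard (N D : ℕ) [NeZero N] : NetFun.{u} ((ℕ × ℕ) × ℕ) (ℕ → ℕ) :=
  fun _ _ P x v p => (exchange (β := Fin N) 1 P (fun v p _ => if IsUp (x v).1 p then
    Fin.ofNat N (subtreeCard N D P x v) else 0) v p 0 : Fin N)

/-- Consecutive numbers for the members of a set of nodes. -/
def numbering (N D : ℕ) [NeZero N] : NetFun.{u} ((ℕ × ℕ) × ℕ) ℕ :=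
  fun _ _ P x v => (passDown (β := Fin N) (offset N) D P
    (fun v => ((x v).1, ((x v).2, childCard N D P x v), fun _ => 0)) v 0 : ℕ)

theorem realizable_numbering {N b : ℕ} [NeZero N] (hN : N ≤ 2 ^ b) (D : ℕ) :
    Realizable b (D + 1 + D) (numbering.{u} N D) := by
  have h1 : Realizable b D (subtreeCard.{u} N D) :=
    ((realizable_upSum hN D D).precomp (fun _ (x : (ℕ × ℕ) × ℕ) => (x.1, fun _ => x.2))).map (fun _ y => y 0)
  have h2 := (realizable_exchange.{u} (β := Fin N) (b := b) (by simpa using hN) 1).precomp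
    (fun _ (y : ((ℕ × ℕ) × ℕ) × ℕ) p _ => if IsUp y.1.1 p then Fin.ofNat N y.2 else 0)
  have h3 : Realizable b (D + 1) (childCard.{u} N D) :=
    ((h1.remember id).comp h2).map (fun _ y p => (y p 0 : ℕ))
  have h4 := (realizable_passDown.{u} (β := Fin N) (b := b) (by simpa using hN)
    (offset N) D).precomp (fun _ (y : ((ℕ × ℕ) × ℕ) × (ℕ → ℕ)) =>
      (y.1.1, (y.1.2, y.2), fun _ => 0))
  exact ((h3.remember id).comp h4).map (fun _ y => (y 0 : ℕ))

/-- In preorder the members below `v` own the interval of length `a v` starting at `off v`.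
Descending from the root, `i` is either the number of the current member or lies in the interval of
exactly one child. -/
theorem exists_numbering_eq {V : Type u} [Fintype V] {G : SimpleGraph V} {P : PortNumbering G}
    {tr : V → ℕ × ℕ} {r : V} {D : ℕ} (hT : IsTree P tr r D) (N : ℕ) [NeZero N]
    (A : Finset V) [DecidablePred (· ∈ A)] (hN : A.card < N) (i : ℕ) (hi : i < A.card) :
    ∃ v ∈ A, numbering N D P (fun v => (tr v, if v ∈ A then 1 else 0)) v = i := by
  set x : V → (ℕ × ℕ) × ℕ := fun v => (tr v, if v ∈ A then 1 else 0) with hx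
  set m : V → ℕ := fun v => if v ∈ A then 1 else 0 with hm
  have hsum : ∑ v, m v = A.card := by simp [hm]
  set a := subtreeCard N D P x with ha
  obtain ⟨hrec, hle, hroot⟩ := hT.subtree_sum (a := a) (x := m) (N := N)
    (fun v => upSum_eq hT N D (fun v _ => m v) v 0 (by omega)) (hsum ▸ hN)
  rw [hsum] at hle hroot
  set off := numbering N D P x with hoff
  have hoffr : off r = 0 := by
    rw [hoff, numbering, passDown_root hT]
    rfl
  have hchild : ∀ v (q : Fin (P.deg v)),
      childCard N D P x v q = if IsChild P tr v q then a (P.peer v q) else 0 := by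
    intro v q
    rw [childCard, exchange_eq _ _ _ _ _ _ one_pos]
    change ((if IsChild P tr v q then _ else _ : Fin N) : ℕ) = _
    split_ifs
    · exact Nat.mod_eq_of_lt ((hle _).trans_lt hN)
    · rfl
  have hoffc : ∀ v (q : Fin (P.deg v)), IsChild P tr v q → off (P.peer v q) =
      (off v + m v + ∑ p ∈ Finset.range q, childCard N D P x v p) % N := fun v q hq =>
    congrArg Fin.val (passDown_eq hT (offset N) D (fun v => (m v, childCard N D P x v))
      (fun _ _ => 0) v q hq 0 (by omega))
  have main : ∀ k v, (tr v).1 + k = D → off v ≤ i → i < off v + a v → ∃ u ∈ A, off u = i := by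
    intro k
    induction k with
    | zero =>
      intro v hv h1 h2
      have : a v = m v := by
        rw [hrec, Finset.sum_eq_zero, add_zero]
        intro q _
        rw [if_neg]
        intro hq
        have := hT.depth_child hq
        have := hT.le (P.peer v q)
        omega
      by_cases hvA : v ∈ A
      · exact ⟨v, hvA, by simp [this, hm, hvA] at h2; omega⟩
      · simp [this, hm, hvA] at h2; omega
    | succ k ih =>
      intro v hv h1 h2
      by_cases hvA : v ∈ A ∧ off v = i
      · exact ⟨v, hvA.1, hvA.2⟩
      have hmi : off v + m v ≤ i := by
        by_cases h : v ∈ A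
        · have : m v = 1 := by simp [hm, h]
          have : off v ≠ i := fun e => hvA ⟨h, e⟩
          omega
        · have : m v = 0 := by simp [hm, h]
          omega
      rw [hrec] at h2
      simp_rw [← hchild] at h2
      obtain ⟨q, hq1, hq2⟩ := exists_prefix_sum (fun q : Fin (P.deg v) => childCard N D P x v q)
        (i - (off v + m v)) (by omega)
      rw [sum_filter_lt_fin (childCard N D P x v)] at hq1 hq2
      by_cases hc : IsChild P tr v q
      · have h3 := hoffc v q hc
        rw [Nat.mod_eq_of_lt (by omega)] at h3
        have h4 := hchild v q
        rw [if_pos hc] at h4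
        exact ih (P.peer v q) (by have := hT.depth_child hc; omega) (by omega) (by omega)
      · have h4 := hchild v q
        rw [if_neg hc] at h4
        omega
  exact main D r (by rw [hT.root, zero_add]) (by omega) (by omega)

/-- All numbers below `A.card` occur on `A`, so by counting none is repeated and no others occur. -/
theorem numbering_spec {V : Type u} [Fintype V] {G : SimpleGraph V} {P : PortNumbering G}
    {tr : V → ℕ × ℕ} {r : V} {D : ℕ} (hT : IsTree P tr r D) (N : ℕ) [NeZero N]
    (A : Finset V) [DecidablePred (· ∈ A)] (hN : A.card < N) :
    Set.InjOn (numbering N D P (fun v => (tr v, if v ∈ A then 1 else 0))) A ∧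
      ∀ v ∈ A, numbering N D P (fun v => (tr v, if v ∈ A then 1 else 0)) v < A.card := by
  classical
  set f := numbering N D P (fun v => (tr v, if v ∈ A then 1 else 0)) with hf
  have hsub : Finset.range A.card ⊆ A.image f := by
    intro i hi
    obtain ⟨v, hv, h⟩ := exists_numbering_eq hT N A hN i (by simpa using hi)
    exact Finset.mem_image.2 ⟨v, hv, h⟩
  have heq : Finset.range A.card = A.image f :=
    Finset.eq_of_subset_of_card_le hsub (by simpa using Finset.card_image_le)
  constructor
  · rw [← Finset.card_image_iff, ← heq, Finset.card_range]
  · intro v hv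
    have : f v ∈ A.image f := Finset.mem_image_of_mem f hv
    rw [← heq] at this
    simpa using this

open Finset

/-! ### Separation of weight functions by few random sets -/

section Separation

variable {Z : Type*} [Fintype Z]

/-- At most half of all subsets have equal weights for two different weight functions. -/
theorem two_mul_card_equal_le {w w' : Z → ℕ} (hw : w ≠ w') [DecidableEq Z] :
    2 * #{h : Z → Bool | ∑ z with h z, w z = ∑ z with h z, w' z} ≤ Fintype.card (Z → Bool) := by
  obtain ⟨z₀, hz⟩ := Function.ne_iff.1 hw
  set B := ({h : Z → Bool | ∑ z with h z, w z = ∑ z with h z, w' z} : Finset _) with hB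
  have hsum : ∀ (x : Z → ℕ) (h : Z → Bool),
      ∑ z with h z, x z = (if h z₀ then x z₀ else 0) + ∑ z ∈ univ.erase z₀, if h z then x z else 0 := by
    intro x h
    rw [sum_filter, ← add_sum_erase univ _ (mem_univ z₀)]
  have hle : #B ≤ #Bᶜ := by
    -- Toggling a point where the weights differ destroys equality of the sums.
    refine card_le_card_of_injOn (fun h => Function.update h z₀ (!h z₀)) ?_ ?_
    · intro h hh
      simp only [hB, mem_coe, mem_filter, mem_univ, true_and, mem_compl] at hh ⊢
      intro hh'
      rw [hsum w, hsum w'] at hh hh'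
      have hu : ∀ x : Z → ℕ, (∑ z ∈ univ.erase z₀,
          if Function.update h z₀ (!h z₀) z then x z else 0) =
            ∑ z ∈ univ.erase z₀, if h z then x z else 0 := by
        intro x
        refine sum_congr rfl fun z hz => ?_
        rw [Function.update_of_ne (ne_of_mem_erase hz)]
      rw [hu, hu] at hh'
      cases hb : h z₀ <;> simp [hb] at hh hh' <;> omega
    · intro h _ h' _ heq
      funext z
      have := congrFun heq z
      by_cases hz : z = z₀
      · subst hz
        simpa using this
      · simpa [hz] using this
  have := card_compl_add_card B
  omega

/-- Union bound: for a pair of different weight functions, `k` independent random sets all fail with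
probability at most `2⁻ᵏ`, and there are fewer than `2ᵏ` pairs. -/
theorem exists_separating {ι : Type*} [Fintype ι] (w : ι → Z → ℕ) (k : ℕ)
    (hk : Fintype.card ι ^ 2 < 2 ^ k) :
    ∃ h : Fin k → Z → Bool, ∀ i i',
      (∀ j, ∑ z with h j z, w i z = ∑ z with h j z, w i' z) → w i = w i' := by
  classical
  by_contra hcon
  push Not at hcon
  set bad : ι × ι → Finset (Fin k → Z → Bool) := fun p =>
    if w p.1 = w p.2 then ∅ else
      Fintype.piFinset fun _ => {h : Z → Bool | ∑ z with h z, w p.1 z = ∑ z with h z, w p.2 z}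
  have hcover : (univ : Finset (Fin k → Z → Bool)) ⊆ univ.biUnion bad := by
    intro h _
    obtain ⟨i, i', h1, h2⟩ := hcon h
    refine mem_biUnion.2 ⟨(i, i'), mem_univ _, ?_⟩
    simp only [bad, if_neg h2, Fintype.mem_piFinset, mem_filter, mem_univ, true_and]
    exact h1
  have hbad : ∀ p, 2 ^ k * #(bad p) ≤ Fintype.card (Z → Bool) ^ k := by
    intro p
    simp only [bad]
    split_ifs with h
    · simp
    · rw [Fintype.card_piFinset, prod_const, card_univ, Fintype.card_fin, ← mul_pow]
      exact Nat.pow_le_pow_left (two_mul_card_equal_le h) k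
  have h1 : Fintype.card (Z → Bool) ^ k ≤ ∑ p, #(bad p) := by
    have := (card_le_card hcover).trans card_biUnion_le
    rwa [card_univ, Fintype.card_fun, Fintype.card_fin] at this
  have hpos : 0 < Fintype.card (Z → Bool) ^ k := pow_pos Fintype.card_pos k
  have h2 : 2 ^ k * ∑ p, #(bad p) ≤ Fintype.card ι ^ 2 * Fintype.card (Z → Bool) ^ k := by
    rw [mul_sum]
    refine (sum_le_card_nsmul _ _ _ fun p _ => hbad p).trans (le_of_eq ?_)
    rw [card_univ, Fintype.card_prod, smul_eq_mul, sq]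
  have h3 := (Nat.mul_le_mul_left (2 ^ k) h1).trans h2
  exact absurd (Nat.le_of_mul_le_mul_right h3 hpos) hk.not_ge

end Separation

/-! ### Class sizes and edge counts of a labelling -/

section Weight

variable {V W L : Type*} [Fintype V] [Fintype W]

open Classical in
/-- The numbers of nodes with a given label, and of adjacent pairs of nodes with given labels. -/
noncomputable def weight (H : SimpleGraph V) (f : V → L) : L ⊕ L × L → ℕ :=
  Sum.elim (fun a => #{v | f v = a}) (fun a => #{p : V × V | H.Adj p.1 p.2 ∧ (f p.1, f p.2) = a})

open Classical in
-- Splits a total count into contributions that each node can compute from its own label and those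
-- of its neighbours.
theorem sum_weight [Fintype L] (H : SimpleGraph V) (f : V → L) (h : L ⊕ L × L → Bool) :
    ∑ z with h z, weight H f z = ∑ v, ((if h (Sum.inl (f v)) then 1 else 0) +
      ∑ w, if H.Adj v w ∧ h (Sum.inr (f v, f w)) then 1 else 0) := by
  rw [sum_filter, Fintype.sum_sum_type, sum_add_distrib]
  congr 1
  · simp only [weight, Sum.elim_inl, card_filter]
    simp_rw [← sum_filter (fun a => h (Sum.inl a) = true)]
    rw [sum_comm]
    refine sum_congr rfl fun v _ => ?_
    rw [sum_filter]
    simp_rw [← ite_and, and_comm, ite_and]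
    simp
  · rw [← Fintype.sum_prod_type' (f := fun v w =>
      if H.Adj v w ∧ h (Sum.inr (f v, f w)) then 1 else 0)]
    simp only [weight, Sum.elim_inr, card_filter]
    simp_rw [← sum_filter (fun a => h (Sum.inr a) = true)]
    rw [sum_comm]
    refine sum_congr rfl fun v _ => ?_
    rw [sum_filter]
    by_cases hv : H.Adj v.1 v.2
    · simp_rw [hv, true_and, ← ite_and, and_comm, ite_and]
      simp
    · simp [hv]

theorem weight_comp_iso (GV : SimpleGraph V) (GW : SimpleGraph W) (e : GV ≃g GW) (f : W → L) :
    weight GV (fun v => f (e v)) = weight GW f := by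
  classical
  funext z
  rcases z with a | a
  · simp only [weight, Sum.elim_inl]
    exact card_equiv e.toEquiv (by simp)
  · simp only [weight, Sum.elim_inr]
    exact card_equiv (e.toEquiv.prodCongr e.toEquiv) (by simp [e.map_adj_iff])

open Classical in
-- Rules out overflow when the counts are summed along the tree.
theorem weight_sum_le [Fintype L] (H : SimpleGraph V) (f : V → L) (h : L ⊕ L × L → Bool) :
    ∑ z with h z, weight H f z ≤ Fintype.card V + Fintype.card V ^ 2 := by
  rw [sum_weight, sum_add_distrib, sq]
  gcongr
  · refine (sum_le_card_nsmul _ _ 1 fun v _ => by split_ifs <;> simp).trans ?_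
    simp
  · refine (sum_le_card_nsmul _ _ (Fintype.card V) fun v _ => ?_).trans ?_
    · refine (sum_le_card_nsmul _ _ 1 fun v _ => by split_ifs <;> simp).trans ?_
      simp
    · simp

end Weight

/-! ### Label preserving bijections -/

section Close

open Classical in
/-- The indicator of `¬ (p ↔ q)`. -/
noncomputable def mismatch (p q : Prop) : ℝ := if p ↔ q then 0 else 1

theorem mismatch_nonneg (p q : Prop) : 0 ≤ mismatch p q := by
  rw [mismatch]; split_ifs <;> simp

theorem mismatch_triangle (p q r : Prop) : mismatch p r ≤ mismatch p q + mismatch q r := by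
  by_cases hp : p <;> by_cases hq : q <;> by_cases hr : r <;> simp [mismatch, hp, hq, hr]

theorem mismatch_le_add (p q : Prop) [Decidable p] [Decidable q] :
    mismatch p q ≤ (if p then 1 else 0) + (if q then 1 else 0) := by
  by_cases hp : p <;> by_cases hq : q <;> simp [mismatch, hp, hq]

theorem mismatch_not (p q : Prop) : mismatch (¬ p) (¬ q) = mismatch p q := by
  by_cases hp : p <;> by_cases hq : q <;> simp [mismatch, hp, hq]

/-- Two subsets of `S` of the same size differ little when the first one is almost trivial. -/
theorem sum_mismatch_mul_card_le {E : Type*} (S : Finset E) (A B : E → Prop) [DecidablePred A]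
    [DecidablePred B] (hAB : #{e ∈ S | A e} = #{e ∈ S | B e}) :
    (∑ e ∈ S, mismatch (A e) (B e)) * #S ≤ 2 * ∑ e ∈ S, ∑ e' ∈ S, mismatch (A e) (A e') := by
  set a : ℝ := ((#{e ∈ S | A e} : ℕ) : ℝ) with ha
  set a' : ℝ := ((#{e ∈ S | ¬ A e} : ℕ) : ℝ) with ha'
  have hB : (#{e ∈ S | B e} : ℝ) = a := by rw [← hAB]
  have hs : (#S : ℝ) = a + a' := by
    rw [ha, ha', ← card_filter_add_card_filter_not (s := S) A]
    push_cast; rfl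
  have hB' : (#{e ∈ S | ¬ B e} : ℝ) = a' := by
    have : (#S : ℝ) = #{e ∈ S | B e} + #{e ∈ S | ¬ B e} := by
      rw [← card_filter_add_card_filter_not (s := S) B]
      push_cast; rfl
    linarith
  have h1 : ∑ e ∈ S, mismatch (A e) (B e) ≤ 2 * a := by
    refine (sum_le_sum fun e _ => mismatch_le_add (A e) (B e)).trans ?_
    rw [sum_add_distrib, sum_boole, sum_boole, hB]
    linarith
  have h2 : ∑ e ∈ S, mismatch (A e) (B e) ≤ 2 * a' := by
    refine (sum_le_sum fun e _ => (mismatch_not (A e) (B e)).symm.le.trans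
      (mismatch_le_add (¬ A e) (¬ B e))).trans ?_
    rw [sum_add_distrib, sum_boole, sum_boole, hB']
    linarith
  have h3 : ∑ e ∈ S, ∑ e' ∈ S, mismatch (A e) (A e') = 2 * (a * a') := by
    have : ∀ e e', mismatch (A e) (A e') = (if A e then 1 else 0) * (if ¬ A e' then 1 else 0) +
        (if ¬ A e then 1 else 0) * (if A e' then 1 else 0) := by
      intro e e'
      by_cases h : A e <;> by_cases h' : A e' <;> simp [mismatch, h, h']
    simp_rw [this, sum_add_distrib, ← mul_sum, ← sum_mul, sum_boole]
    ring
  rw [h3, hs, mul_add]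
  have hpa : 0 ≤ a := Nat.cast_nonneg _
  have hpa' : 0 ≤ a' := Nat.cast_nonneg _
  -- If `M` is the number of mismatches, then `M * a` and `M * a'` are both at most `2 * a * a'`;
  -- add the two bounds.
  nlinarith [mul_le_mul_of_nonneg_right h2 hpa, mul_le_mul_of_nonneg_right h1 hpa']

variable {V W L : Type*} [Fintype V] [Fintype W]

open Classical in
theorem adjDist_map_eq (GV : SimpleGraph V) (GW : SimpleGraph W) (g : V ≃ W) :
    (adjDist (GV.map g) GW : ℝ) = ∑ u, ∑ v, mismatch (GV.Adj u v) (GW.Adj (g u) (g v)) := by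
  rw [← Fintype.sum_prod_type' (f := fun u v => mismatch (GV.Adj u v) (GW.Adj (g u) (g v)))]
  have : ∀ p q, mismatch p q = if ¬ (p ↔ q) then 1 else 0 := by
    intro p q
    rw [mismatch]
    split_ifs <;> simp_all
  simp_rw [this]
  rw [sum_boole, adjDist, Set.ncard_eq_toFinset_card']
  congr 1
  refine (card_equiv (g.prodCongr g) ?_).symm
  rintro ⟨u, v⟩
  have : (GV.map g).Adj (g u) (g v) ↔ GV.Adj u v :=
    SimpleGraph.map_adj_apply (f := g.toEmbedding)
  simp [this]

open Classical in
-- For classes `a`, `a'`, equal edge counts bound the mismatches `M a a'` by the variation of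
-- `GV.Adj` over pairs in `P a ×ˢ P a'`. Changing one endpoint at a time bounds this by `X a a'` and
-- `X a' a`, which compare classmates. The sum of `X a a' / #(P a)` is at most `Fintype.card V * κ`;
-- it occurs twice, with a factor 2.
theorem adjDist_le_of_weight_eq [Fintype L] {GV : SimpleGraph V} {GW : SimpleGraph W} {f : V → L}
    {f' : W → L} (hw : weight GV f = weight GW f') (g : V ≃ W) (hg : ∀ v, f' (g v) = f v) {κ : ℝ}
    (hκ : ∀ u u', f u = f u' → ∑ v, mismatch (GV.Adj u v) (GV.Adj u' v) ≤ κ) :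
    (adjDist (GV.map g) GW : ℝ) ≤ 4 * (Fintype.card V * κ) := by
  set P : L → Finset V := fun a => {v | f v = a} with hP
  set X : L → L → ℝ := fun a a' => ∑ u ∈ P a, ∑ u' ∈ P a, ∑ v ∈ P a',
    mismatch (GV.Adj u v) (GV.Adj u' v) with hX
  set M : L → L → ℝ := fun a a' => ∑ u ∈ P a, ∑ v ∈ P a',
    mismatch (GV.Adj u v) (GW.Adj (g u) (g v)) with hM
  have hX0 : ∀ a a', 0 ≤ X a a' := fun a a' => sum_nonneg fun _ _ => sum_nonneg fun _ _ =>
    sum_nonneg fun _ _ => mismatch_nonneg _ _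
  have hsplit : ∀ F : V → ℝ, ∑ v, F v = ∑ a, ∑ v ∈ P a, F v := fun F =>
    (sum_fiberwise univ f F).symm
  have hcard : ∑ a, (#(P a) : ℝ) = Fintype.card V := by
    have := hsplit (fun _ => 1)
    simp at this
    exact this.symm
  have hM1 : ∀ a a', M a a' * (#(P a) * #(P a')) ≤ 2 * (#(P a') * X a a' + #(P a) * X a' a) := by
    intro a a'
    have hcount : #{e ∈ P a ×ˢ P a' | GV.Adj e.1 e.2} =
        #{e ∈ P a ×ˢ P a' | GW.Adj (g e.1) (g e.2)} := by
      have h1 := congrFun hw (Sum.inr (a, a'))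
      simp only [weight, Sum.elim_inr] at h1
      have h2 : #{e ∈ P a ×ˢ P a' | GV.Adj e.1 e.2} =
          #{p : V × V | GV.Adj p.1 p.2 ∧ (f p.1, f p.2) = (a, a')} := by
        congr 1
        ext ⟨u, v⟩
        simp [hP]
        tauto
      have h3 : #{e ∈ P a ×ˢ P a' | GW.Adj (g e.1) (g e.2)} =
          #{p : W × W | GW.Adj p.1 p.2 ∧ (f' p.1, f' p.2) = (a, a')} := by
        refine card_equiv (g.prodCongr g) ?_
        rintro ⟨u, v⟩
        simp [hP, hg]
        tauto
      rw [h2, h3, h1]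
    have h := sum_mismatch_mul_card_le (P a ×ˢ P a') (fun e => GV.Adj e.1 e.2)
      (fun e => GW.Adj (g e.1) (g e.2)) hcount
    rw [sum_product, card_product, Nat.cast_mul] at h
    refine h.trans (mul_le_mul_of_nonneg_left ?_ zero_le_two)
    calc ∑ e ∈ P a ×ˢ P a', ∑ e' ∈ P a ×ˢ P a', mismatch (GV.Adj e.1 e.2) (GV.Adj e'.1 e'.2)
        ≤ ∑ e ∈ P a ×ˢ P a', ∑ e' ∈ P a ×ˢ P a', (mismatch (GV.Adj e.1 e.2) (GV.Adj e'.1 e.2) +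
            mismatch (GV.Adj e'.1 e.2) (GV.Adj e'.1 e'.2)) :=
          sum_le_sum fun e _ => sum_le_sum fun e' _ => mismatch_triangle _ _ _
      _ = #(P a') * X a a' + #(P a) * X a' a := by
          simp_rw [sum_add_distrib, sum_product, sum_const, nsmul_eq_mul, hX]
          congr 1
          · simp_rw [← mul_sum]
            congr 1
            exact sum_congr rfl fun u _ => sum_comm
          · congr 1
            refine sum_congr rfl fun v _ => ?_
            rw [sum_comm]
            refine sum_congr rfl fun v' _ => sum_congr rfl fun u _ => ?_
            rw [GV.adj_comm u v, GV.adj_comm u v']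
  have hM2 : ∀ a a', M a a' ≤ 2 * (X a a' / #(P a) + X a' a / #(P a')) := by
    intro a a'
    rcases (P a).eq_empty_or_nonempty with h | h
    · have : M a a' = 0 := by simp [hM, h]
      rw [this]
      have := hX0 a a'
      have := hX0 a' a
      positivity
    rcases (P a').eq_empty_or_nonempty with h' | h'
    · have : M a a' = 0 := by simp [hM, h']
      rw [this]
      have := hX0 a a'
      have := hX0 a' a
      positivity
    have hp : (0 : ℝ) < #(P a) := by exact_mod_cast h.card_pos
    have hp' : (0 : ℝ) < #(P a') := by exact_mod_cast h'.card_pos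
    refine le_of_mul_le_mul_right ((hM1 a a').trans (le_of_eq ?_)) (mul_pos hp hp')
    field_simp
  have hXsum : ∑ a, ∑ a', X a a' / #(P a) ≤ Fintype.card V * κ := by
    rw [← hcard, sum_mul]
    refine sum_le_sum fun a _ => ?_
    rw [← sum_div]
    rcases (P a).eq_empty_or_nonempty with h | h
    · simp [h]
    have hp : (0 : ℝ) < #(P a) := by exact_mod_cast h.card_pos
    rw [div_le_iff₀ hp]
    have : ∑ a', X a a' = ∑ u ∈ P a, ∑ u' ∈ P a, ∑ v, mismatch (GV.Adj u v) (GV.Adj u' v) := by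
      simp_rw [hX, hsplit]
      rw [sum_comm]
      exact sum_congr rfl fun u _ => sum_comm
    rw [this]
    calc _ ≤ ∑ u ∈ P a, ∑ u' ∈ P a, κ := sum_le_sum fun u hu => sum_le_sum fun u' hu' =>
          hκ u u' (by simp [hP] at hu hu'; rw [hu, hu'])
      _ = _ := by simp; ring
  rw [adjDist_map_eq]
  calc ∑ u, ∑ v, mismatch (GV.Adj u v) (GW.Adj (g u) (g v)) = ∑ a, ∑ a', M a a' := by
        rw [hsplit]
        refine sum_congr rfl fun a _ => ?_
        simp_rw [hM]
        rw [sum_comm (s := univ)]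
        exact sum_congr rfl fun u _ => hsplit _
    _ ≤ ∑ a, ∑ a', 2 * (X a a' / #(P a) + X a' a / #(P a')) :=
        sum_le_sum fun a _ => sum_le_sum fun a' _ => hM2 a a'
    _ = 2 * (∑ a, ∑ a', X a a' / #(P a) + ∑ a, ∑ a', X a a' / #(P a)) := by
        simp_rw [← mul_sum, sum_add_distrib]
        congr 2
        exact sum_comm
    _ ≤ _ := by linarith

end Close

/-! ### Random samples -/

section Sample

open Classical in
/-- The label of a node with respect to a sample `C` of nodes. -/
noncomputable def label {V : Type*} (G : SimpleGraph V) {m : ℕ} (C : Fin m → V) (v : V) :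
    Fin m → Bool :=
  fun i => decide (G.Adj v (C i))

variable {V : Type*} [Fintype V]

open Classical in
-- Equal labels force all `m` samples into the set where the two neighbourhoods agree.
theorem card_label_eq_le (G : SimpleGraph V) (m : ℕ) (δ : ℝ) (u v : V)
    (h : δ * Fintype.card V < ∑ w, mismatch (G.Adj u w) (G.Adj v w)) :
    (#{C : Fin m → V | label G C u = label G C v} : ℝ) ≤ ((1 - δ) * Fintype.card V) ^ m := by
  set S : Finset V := {w | G.Adj u w ↔ G.Adj v w} with hS
  have h1 : #{C : Fin m → V | label G C u = label G C v} ≤ #S ^ m := by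
    have : #S ^ m = #(Fintype.piFinset fun _ : Fin m => S) := by simp
    rw [this]
    refine card_le_card fun C hC => ?_
    simp only [mem_filter, mem_univ, true_and] at hC
    simp only [Fintype.mem_piFinset, hS, mem_filter, mem_univ, true_and]
    intro i
    simpa [label] using congrFun hC i
  have h2 : (#S : ℝ) + ∑ w, mismatch (G.Adj u w) (G.Adj v w) = Fintype.card V := by
    rw [hS, card_filter]
    push_cast
    rw [← sum_add_distrib]
    have : ∀ w, (if G.Adj u w ↔ G.Adj v w then (1 : ℝ) else 0) +
        mismatch (G.Adj u w) (G.Adj v w) = 1 := by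
      intro w
      rw [mismatch]
      split_ifs <;> simp
    simp [this]
  calc (#{C : Fin m → V | label G C u = label G C v} : ℝ) ≤ (#S : ℝ) ^ m := by exact_mod_cast h1
    _ ≤ _ := by
      gcongr
      linarith

open Classical in
/-- Few samples fail to separate some pair of nodes with rather different neighbourhoods. -/
theorem card_bad_sample_le (G : SimpleGraph V) (m c : ℕ) (δ : ℝ) (hδ1 : δ < 1)
    (hm : (c + 2) * Real.log (Fintype.card V) ≤ δ * m) (hV : 0 < Fintype.card V) :
    (#{C : Fin m → V | ∃ u v, label G C u = label G C v ∧
      δ * Fintype.card V < ∑ w, mismatch (G.Adj u w) (G.Adj v w)} : ℝ) ≤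
        (Fintype.card V : ℝ) ^ m / (Fintype.card V : ℝ) ^ c := by
  set n := Fintype.card V with hn
  have hn0 : (0 : ℝ) < n := by exact_mod_cast hV
  have h1 : ({C : Fin m → V | ∃ u v, label G C u = label G C v ∧
      δ * n < ∑ w, mismatch (G.Adj u w) (G.Adj v w)} : Finset _) ⊆
        (univ : Finset (V × V)).biUnion fun p =>
          if δ * n < ∑ w, mismatch (G.Adj p.1 w) (G.Adj p.2 w) then
            ({C : Fin m → V | label G C p.1 = label G C p.2} : Finset _) else ∅ := by
    intro C hC
    simp only [mem_filter, mem_univ, true_and] at hC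
    obtain ⟨u, v, h, h'⟩ := hC
    refine mem_biUnion.2 ⟨(u, v), mem_univ _, ?_⟩
    rw [if_pos h']
    simpa using h
  have h2 : (#{C : Fin m → V | ∃ u v, label G C u = label G C v ∧
      δ * n < ∑ w, mismatch (G.Adj u w) (G.Adj v w)} : ℝ) ≤ n ^ 2 * ((1 - δ) * n) ^ m := by
    calc _ ≤ ((∑ p : V × V, #(if δ * n < ∑ w, mismatch (G.Adj p.1 w) (G.Adj p.2 w) then
            ({C : Fin m → V | label G C p.1 = label G C p.2} : Finset _) else ∅) : ℕ) : ℝ) := by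
          exact_mod_cast (card_le_card h1).trans card_biUnion_le
      _ ≤ ∑ p : V × V, ((1 - δ) * n) ^ m := by
          push_cast
          refine sum_le_sum fun p _ => ?_
          split_ifs with h
          · exact card_label_eq_le G m δ p.1 p.2 h
          · have : 0 ≤ (1 - δ) * n := mul_nonneg (by linarith) hn0.le
            simpa using pow_nonneg this m
      _ = _ := by
          rw [sum_const, card_univ, Fintype.card_prod, ← hn, nsmul_eq_mul]
          push_cast
          ring
  refine h2.trans ?_
  -- Two of the `c + 2` powers of `n` pay for the union bound over pairs of nodes.
  have h3 : (1 - δ) ^ m ≤ 1 / (n : ℝ) ^ (c + 2) := by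
    calc (1 - δ) ^ m ≤ Real.exp (-δ) ^ m := by
          have := Real.add_one_le_exp (-δ)
          exact pow_le_pow_left₀ (by linarith) (by linarith) m
      _ = Real.exp (-(δ * m)) := by rw [← Real.exp_nat_mul]; ring_nf
      _ ≤ Real.exp (-((c + 2) * Real.log n)) := Real.exp_le_exp.2 (by linarith)
      _ = _ := by
          rw [Real.exp_neg, one_div]
          congr 1
          rw [← Real.exp_log (pow_pos hn0 (c + 2)), Real.log_pow]
          push_cast
          rfl
  rw [mul_pow]
  calc (n : ℝ) ^ 2 * ((1 - δ) ^ m * n ^ m) ≤ n ^ 2 * (1 / (n : ℝ) ^ (c + 2) * n ^ m) := by gcongr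
    _ = _ := by
      rw [pow_add]
      field_simp

end Sample

namespace PortNumbering

variable {V : Type*} {G : SimpleGraph V} (P : PortNumbering G)

open Classical in
theorem sum_peer [Fintype V] {M : Type*} [AddCommMonoid M] (v : V) (F : V → M) :
    ∑ p, F (P.peer v p) = ∑ w, if G.Adj v w then F w else 0 := by
  rw [← sum_filter]
  refine sum_bij (fun p _ => P.peer v p) (fun p _ => by simpa using P.adj_peer v p)
    (fun p _ q _ h => P.peer_injective v h) (fun w hw => ?_) (fun _ _ => rfl)
  obtain ⟨p, hp⟩ := P.exists_peer (by simpa using hw : G.Adj v w)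
  exact ⟨p, mem_univ _, hp⟩

end PortNumbering

/-- Labels of the nodes with respect to a sample of size `m`. -/
abbrev Lab (m : ℕ) : Type := Fin m → Bool

/-! ### Sampling nodes and computing labels -/

/-- The nodes can compute a spanning tree with a root `r`, interpret the seed of `r` as a uniformly
distributed sample of nodes, and learn their own labels, those of their neighbours, and which of
their neighbours belong to the sample. -/
theorem exists_sampling {n m D N a b : ℕ} [NeZero n] [NeZero N] (hn : n < N) (hN : N ≤ 2 ^ b)
    (hab : n ^ a + 1 ≤ 2 ^ b) :
    ∃ F : NetFun.{u} (ℕ × (Fin m → Fin n)) ((ℕ × ℕ) × Lab m × (ℕ → Lab m) × (ℕ → Lab m)),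
      Realizable b (D + (D + 1 + D) + (m + D) + m + m) F ∧
      ∀ (V : Type u) [Fintype V] (G : SimpleGraph V) (P : PortNumbering G) (ident : V → ℕ),
        G.Connected → (∀ u v, G.dist u v ≤ D) → Fintype.card V = n →
        Function.Injective ident → (∀ v, ident v ≤ n ^ a) →
        ∃ (r : V) (e : V ≃ Fin n) (tr : V → ℕ × ℕ), IsTree P tr r D ∧
          ∀ (ω : V → Fin m → Fin n), ∃ nb bits : V → ℕ → Lab m,
            (F P (fun v => (ident v, ω v)) =
              fun v => (tr v, label G (fun i => e.symm (ω r i)) v, nb v, bits v)) ∧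
            (∀ v (p : Fin (P.deg v)), nb v p = label G (fun i => e.symm (ω r i)) (P.peer v p)) ∧
            (∀ v (p : Fin (P.deg v)) i, bits v p i = true ↔ P.peer v p = e.symm (ω r i)) := by
  classical
  have h2b : Nat.card Bool ≤ 2 ^ b := by
    have : 0 < n := NeZero.pos n
    simp
    omega
  have h1 := ((realizable_elect.{u} (α := Fin (n ^ a + 1)) (b := b) (by simpa using hab) D).precomp
    (fun _ (i : ℕ) => Fin.ofNat (n ^ a + 1) i)).remember
      (Prod.fst : ℕ × (Fin m → Fin n) → ℕ)
  have h2 := h1.extend (fun y => (y.2, 1)) (realizable_numbering hN D)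
  have h3 := h2.extend (fun y => (y.1.2, (), fun i => if h : i < m then y.1.1.2 ⟨i, h⟩ else 0))
    (realizable_passDown (β := Fin n) (by simpa using hn.le.trans hN) (fun _ _ y => y) (m + D))
  -- In round `i` every node tells its neighbours whether it is the `i`-th sampled node; hearing one
  -- "yes" sets bit `i` of the label.
  have h4 := (h3.extend (fun y _ i => decide (y.1.2 = (y.2 i : ℕ)))
    (realizable_exchange h2b m)).map
      (fun d y => (y, fun i : Fin m => decide (∃ p < d, y.2 p i = true)))
  have h5 := (h4.extend (fun y _ i => if h : i < m then y.2 ⟨i, h⟩ else false)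
    (realizable_exchange h2b m)).map (fun _ y =>
      (y.1.1.1.1.1.2, y.1.2, (fun p (i : Fin m) => y.2 p i), (fun p (i : Fin m) => y.1.1.2 p i)))
  refine ⟨_, h5, fun V _ G P ident hG hD hV hinj hid => ?_⟩
  obtain ⟨r, hr⟩ : ∃ r, ∀ v, ident r ≤ ident v := by
    have := hG.nonempty
    exact Finite.exists_min ident
  set key : V → Fin (n ^ a + 1) := fun v => Fin.ofNat (n ^ a + 1) (ident v) with hkey
  set tr : V → ℕ × ℕ := elect D P key with htr
  have hT : IsTree P tr r D := by
    refine isTree_elect P hG key r (fun v hv => ?_) D (hD r)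
    rw [Fin.lt_def]
    change ident r % _ < ident v % _
    rw [Nat.mod_eq_of_lt (Nat.lt_succ_of_le (hid r)), Nat.mod_eq_of_lt (Nat.lt_succ_of_le (hid v))]
    exact lt_of_le_of_ne (hr v) fun h => hv (hinj h.symm)
  set num : V → ℕ := numbering N D P (fun v => (tr v, 1)) with hnum
  have hspec := numbering_spec hT N (univ : Finset V) (by rw [card_univ, hV]; exact hn)
  simp only [mem_univ, if_true, card_univ, hV, forall_const, coe_univ, Set.injOn_univ] at hspec
  rw [← hnum] at hspec
  have hbij : Function.Bijective (fun v => (⟨num v, hspec.2 v⟩ : Fin n)) := by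
    rw [Fintype.bijective_iff_injective_and_card]
    exact ⟨fun u v h => hspec.1 (by simpa using h), by simpa using hV⟩
  -- The root and the numbering are independent of `ω`, so a uniform seed of `r` yields a uniform
  -- sample.
  set e : V ≃ Fin n := Equiv.ofBijective _ hbij with he
  refine ⟨r, e, tr, hT, fun ω => ?_⟩
  set C : Fin m → V := fun i => e.symm (ω r i) with hC
  set sd : V → ℕ → Fin n := passDown (fun (_ : Unit) _ y => y) (m + D) P
    (fun v => (tr v, (), fun i => if h : i < m then ω v ⟨i, h⟩ else 0)) with hsd
  have hsd' : ∀ v (i : Fin m), sd v i = ω r i := by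
    intro v i
    rw [hsd, passDown_broadcast hT (m + D) _ _ _ _ (by omega)]
    simp
  set bits : V → ℕ → ℕ → Bool := exchange m P (fun v _ i => decide (num v = (sd v i : ℕ)))
    with hbits
  have hbits' : ∀ v (p : Fin (P.deg v)) (i : Fin m), bits v p i = true ↔ P.peer v p = C i := by
    intro v p i
    rw [hbits, exchange_eq _ _ _ _ _ _ i.2, hsd', decide_eq_true_iff, hC,
      Equiv.eq_symm_apply, Fin.ext_iff]
    rfl
  set lab : V → Lab m := fun v i => decide (∃ p < P.deg v, bits v p i = true) with hlab
  have hlab' : lab = label G C := by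
    funext v i
    rw [hlab, label, decide_eq_decide]
    constructor
    · rintro ⟨p, hp, h⟩
      rw [← (hbits' v ⟨p, hp⟩ i).1 h]
      exact P.adj_peer _ _
    · intro h
      obtain ⟨p, hp⟩ := P.exists_peer h
      exact ⟨p, p.2, (hbits' v p i).2 hp⟩
  refine ⟨fun v p i => exchange m P
      (fun v _ i => if h : i < m then lab v ⟨i, h⟩ else false) v p i, fun v p i => bits v p i,
    ?_, fun v p => ?_, fun v p i => hbits' v p i⟩
  · rw [← hlab']
  · funext i
    change exchange m P (fun v _ i => if h : i < m then lab v ⟨i, h⟩ else false) v p i = _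
    rw [exchange_eq _ _ _ _ _ _ i.2, ← hlab']
    simp

/-! ### Fingerprints of labellings -/

/-- The nodes can compute the weights of `k` given sets of labels and pairs of labels. -/
theorem exists_fingerprint {m k D N b : ℕ} [NeZero N] (hN : N ≤ 2 ^ b)
    (h : Fin k → Lab m ⊕ Lab m × Lab m → Bool) :
    ∃ F : NetFun.{u} ((ℕ × ℕ) × Lab m × (ℕ → Lab m)) (Fin k → ℕ),
      Realizable b ((k + D) + (k + D)) F ∧
      ∀ (V : Type u) [Fintype V] (G : SimpleGraph V) (P : PortNumbering G) (r : V)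
        (tr : V → ℕ × ℕ) (f : V → Lab m) (nb : V → ℕ → Lab m), IsTree P tr r D →
        Fintype.card V + Fintype.card V ^ 2 < N →
        (∀ v (p : Fin (P.deg v)), nb v p = f (P.peer v p)) →
        ∀ v, F P (fun v => (tr v, f v, nb v)) v = fun j => ∑ z with h j z, weight G f z := by
  classical
  set item : ℕ → Lab m → (ℕ → Lab m) → ℕ → ℕ := fun d l nb j =>
    if hj : j < k then (if h ⟨j, hj⟩ (Sum.inl l) then 1 else 0) +
      ∑ p : Fin d, if h ⟨j, hj⟩ (Sum.inr (l, nb p)) then 1 else 0 else 0 with hitem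
  have h1 := (((realizable_upSum.{u} (b := b) hN D (k + D)).remember id).precomp
    (fun d (x : (ℕ × ℕ) × Lab m × (ℕ → Lab m)) => (x.1, item d x.2.1 x.2.2)))
  have h2 := (realizable_passDown.{u} (β := Fin N) (C := Unit) (b := b) (by simpa using hN)
    (fun _ _ y => y) (k + D)).precomp (fun _ (y : ((ℕ × ℕ) × (ℕ → ℕ)) × (ℕ → ℕ)) =>
      (y.1.1, (), fun j => Fin.ofNat N (y.2 j)))
  refine ⟨_, (h1.comp h2).map (fun _ y (j : Fin k) => (y j : ℕ)), ?_⟩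
  intro V _ G P r tr f nb hT hV hnb v
  funext j
  set x : V → ℕ → ℕ := fun v => item (P.deg v) (f v) (nb v) with hx
  change ((passDown (fun (_ : Unit) _ y => y) (k + D) P (fun v => (tr v, (), fun j =>
    Fin.ofNat N (upSum N D (k + D) P (fun v => (tr v, x v)) v j))) v j : Fin N) : ℕ) = _
  rw [passDown_broadcast hT (k + D) _ _ _ _ (by omega)]
  have hsum : ∑ v, x v j = ∑ z with h j z, weight G f z := by
    rw [sum_weight]
    refine sum_congr rfl fun v _ => ?_
    simp only [hx, hitem, j.2, dif_pos, hnb]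
    congr 1
    rw [P.sum_peer v (fun w => if h j (Sum.inr (f v, f w)) then 1 else 0)]
    exact sum_congr rfl fun w _ => (ite_and ..).symm
  have hlt : ∑ v, x v j < N := hsum ▸ (weight_sum_le G f (h j)).trans_lt hV
  change upSum N D (k + D) P (fun v => (tr v, x v)) r j % N = _
  rw [upSum_root hT N (k + D) x j (by omega) hlt, Nat.mod_eq_of_lt hlt, hsum]

/-! ### Ranks within the classes of a labelling -/

/-- The number of ports before `q` with the same entry as `q`. -/
def portRank {L : Type*} [DecidableEq L] (nb : ℕ → L) (q : ℕ) : ℕ := #{p ∈ range q | nb p = nb q}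

theorem portRank_lt {L : Type*} [DecidableEq L] {nb : ℕ → L} {q q' : ℕ} (h : q < q')
    (hnb : nb q = nb q') : portRank nb q < portRank nb q' := by
  refine card_lt_card ⟨fun p hp => ?_, fun hsub => ?_⟩
  · simp only [mem_filter, mem_range] at hp ⊢
    exact ⟨hp.1.trans h, hp.2.trans hnb⟩
  · have : q ∈ ({p ∈ range q | nb p = nb q} : Finset ℕ) := hsub (by simp [h, hnb])
    simp at this

/-- The earlier ports with the same entry lead to distinct members of the class other than `P.peer s
q` itself. So the rank is a valid index into the class. -/
theorem portRank_lt_card {V L : Type*} [Fintype V] [DecidableEq L] {G : SimpleGraph V}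
    (P : PortNumbering G) {f : V → L} {nb : V → ℕ → L}
    (hnb : ∀ v (p : Fin (P.deg v)), nb v p = f (P.peer v p)) (s : V) (q : Fin (P.deg s)) :
    portRank (nb s) q < #{w | f w = f (P.peer s q)} := by
  classical
  have h1 : portRank (nb s) q ≤ #{w ∈ univ.erase (P.peer s q) | f w = f (P.peer s q)} := by
    refine card_le_card_of_injOn (fun p => if hp : p < P.deg s then P.peer s ⟨p, hp⟩ else s) ?_ ?_
    · intro p hp
      simp only [coe_filter, Set.mem_ofPred_eq, mem_range] at hp
      have hps : p < P.deg s := hp.1.trans q.2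
      have := hp.2
      rw [hnb s ⟨p, hps⟩, hnb] at this
      simp only [hps, dif_pos, coe_filter, Set.mem_ofPred_eq, mem_erase, mem_univ, and_true]
      refine ⟨fun e => ?_, this⟩
      have := P.peer_injective s e
      rw [← this] at hp
      exact lt_irrefl _ hp.1
    · intro p hp p' hp' heq
      simp only [coe_filter, Set.mem_ofPred_eq, mem_range] at hp hp'
      have hps : p < P.deg s := hp.1.trans q.2
      have hps' : p' < P.deg s := hp'.1.trans q.2
      simp only [hps, hps', dif_pos] at heq
      simpa using P.peer_injective s heq
  refine h1.trans_lt (card_lt_card ⟨fun w hw => ?_, fun hsub => ?_⟩)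
  · simp only [mem_filter] at hw ⊢
    exact ⟨mem_univ _, hw.2⟩
  · have : P.peer s q ∈ ({w ∈ univ.erase (P.peer s q) | f w = f (P.peer s q)} : Finset V) :=
      hsub (by simp)
    simp at this

open Classical in
/-- The nodes can number the members of each class: a class with a nonzero label has a common
neighbour in the sample, which does this, and the members of the remaining class are numbered along
the tree. -/
theorem exists_ranking {m D N b : ℕ} [NeZero N] (hN : N ≤ 2 ^ b) :
    ∃ F : NetFun.{u} ((ℕ × ℕ) × Lab m × (ℕ → Lab m) × (ℕ → Lab m)) ℕ,
      Realizable b (1 + (D + 1 + D)) F ∧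
      ∀ (V : Type u) [Fintype V] (G : SimpleGraph V) (P : PortNumbering G) (r : V)
        (tr : V → ℕ × ℕ) (C : Fin m → V) (nb bits : V → ℕ → Lab m), IsTree P tr r D →
        Fintype.card V < N →
        (∀ v (p : Fin (P.deg v)), nb v p = label G C (P.peer v p)) →
        (∀ v (p : Fin (P.deg v)) i, bits v p i = true ↔ P.peer v p = C i) →
        (∀ v v', label G C v = label G C v' →
          F P (fun v => (tr v, label G C v, nb v, bits v)) v =
            F P (fun v => (tr v, label G C v, nb v, bits v)) v' → v = v') ∧
        ∀ v, F P (fun v => (tr v, label G C v, nb v, bits v)) v <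
          #{w | label G C w = label G C v} := by
  set X : Type := (ℕ × ℕ) × Lab m × (ℕ → Lab m) × (ℕ → Lab m) with hX
  -- Every node ranks its neighbours by label, whether sampled or not; the receiver keeps only what
  -- a sampled node sent.
  have h1 := (realizable_exchange.{u} (β := Fin N) (b := b) (by simpa using hN) 1).precomp
    (fun _ (nb : ℕ → Lab m) q _ => Fin.ofNat N (portRank nb q))
  have h2 := h1.remember (fun x : X => x.2.2.1)
  have h3 := h2.extend (fun y => (y.1.1, if y.1.2.1 = fun _ => false then 1 else 0))
    (realizable_numbering hN D)
  set out : ℕ → (X × (ℕ → ℕ → Fin N)) × ℕ → ℕ := fun d y =>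
    if h : ∃ i, y.1.1.2.1 i = true then
      if h' : ∃ p < d, y.1.1.2.2.2 p h.choose = true then y.1.2 h'.choose 0 else 0
    else y.2 with hout
  refine ⟨_, h3.map out, fun V _ G P r tr C nb bits hT hV hnb hbits => ?_⟩
  set f := label G C with hf
  set num : V → ℕ := numbering N D P (fun v => (tr v, if f v = fun _ => false then 1 else 0))
    with hnum
  set got : V → ℕ → ℕ → Fin N := exchange 1 P (fun v q _ => Fin.ofNat N (portRank (nb v) q))
    with hgot
  set F : V → ℕ := fun v => out (P.deg v) (((tr v, f v, nb v, bits v), got v), num v) with hF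
  change (∀ v v', f v = f v' → F v = F v' → v = v') ∧ ∀ v, F v < #{w | f w = f v}
  have hpos : ∀ v (h : ∃ i, f v i = true), ∃ p : Fin (P.deg v), P.peer v p = C h.choose ∧
      F v = portRank (nb (P.peer v p)) (P.back v p) := by
    intro v h
    have h' : ∃ p < P.deg v, bits v p h.choose = true := by
      obtain ⟨p, hp⟩ := P.exists_peer
        (of_decide_eq_true (p := G.Adj v (C h.choose)) h.choose_spec)
      exact ⟨p, p.2, (hbits v p _).2 hp⟩
    refine ⟨⟨h'.choose, h'.choose_spec.1⟩, (hbits v ⟨h'.choose, h'.choose_spec.1⟩ _).1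
      h'.choose_spec.2, ?_⟩
    have h4 : F v = (got v h'.choose 0 : ℕ) := by
      simp only [hF, hout]
      rw [dif_pos h, dif_pos h']
    have h5 := exchange_eq 1 P (fun v q _ => Fin.ofNat N (portRank (nb v) q)) v
      ⟨h'.choose, h'.choose_spec.1⟩ 0 one_pos
    rw [h4, hgot, h5]
    exact Nat.mod_eq_of_lt ((portRank_lt_card P hnb _ _).trans_le
      (card_le_univ _) |>.trans hV)
  have hneg : ∀ v, (¬ ∃ i, f v i = true) → f v = (fun _ => false) ∧ F v = num v := by
    intro v h
    refine ⟨?_, by simp only [hF, hout]; rw [dif_neg h]⟩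
    funext i
    push Not at h
    simpa using h i
  have hspec := numbering_spec hT N (univ.filter fun v => f v = fun _ => false)
    ((card_le_univ _).trans_lt hV)
  have hnum' : numbering N D P (fun v => (tr v, if v ∈ univ.filter (fun v => f v = fun _ => false)
      then 1 else 0)) = num := by
    rw [hnum]
    simp only [mem_filter, mem_univ, true_and]
  rw [hnum'] at hspec
  constructor
  · intro v v' hfv hFv
    by_cases h : ∃ i, f v i = true
    · obtain ⟨p, hp, hFp⟩ := hpos v h
      have h' : ∃ i, f v' i = true := hfv ▸ h
      obtain ⟨p', hp', hFp'⟩ := hpos v' h'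
      -- The chosen position depends on the label alone, so classmates rely on the same sampled
      -- node.
      have hc : h.choose = h'.choose := by
        simp only [hfv]
      have hpp : P.peer v p = P.peer v' p' := by rw [hp, hp', hc]
      by_contra hne
      have hb : (P.back v p : ℕ) ≠ P.back v' p' := fun hb => hne (P.eq_of_back_eq hpp hb)
      have hl : nb (P.peer v p) (P.back v p) = f v := by rw [hnb, P.peer_back]
      have hl' : nb (P.peer v' p') (P.back v' p') = f v' := by rw [hnb, P.peer_back]
      rw [hFp, hFp'] at hFv
      -- The port number must become a free variable before the node `P.peer v p` can be rewritten.
      generalize (P.back v p : ℕ) = q at *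
      rw [hpp] at hFv
      rw [hpp] at hl
      rcases lt_or_gt_of_ne hb with hlt | hlt
      · exact (portRank_lt hlt (by rw [hl, hl', hfv])).ne hFv
      · exact (portRank_lt hlt (by rw [hl, hl', hfv])).ne hFv.symm
    · obtain ⟨h1, h2⟩ := hneg v h
      obtain ⟨h1', h2'⟩ := hneg v' (hfv ▸ h)
      exact hspec.1 (by simpa using h1) (by simpa using h1') (by rw [← h2, ← h2', hFv])
  · intro v
    by_cases h : ∃ i, f v i = true
    · obtain ⟨p, hp, hFp⟩ := hpos v h
      have := portRank_lt_card P hnb (P.peer v p) (P.back v p)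
      rw [P.peer_back] at this
      rw [hFp]
      exact this
    · obtain ⟨h1, h2⟩ := hneg v h
      rw [h2, h1]
      exact hspec.2 v (by simpa using h1)

/-! ### Correctness of the outputs -/

open Classical in
-- Equal class sizes make the ranks valid indices into the classes of `GK`, so the outputs form a
-- label-preserving bijection.
theorem isApproxIso_toList {V : Type*} [Fintype V] {n m : ℕ} {GU : SimpleGraph V}
    {GK : SimpleGraph (Fin n)} (hV : Fintype.card V = n) (hn : 0 < n) {ε : ℝ} (hε : 0 < ε)
    (C : Fin m → V) (η : Fin m → Fin n)
    (hgood : ∀ u v, label GU C u = label GU C v →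
      ∑ w, mismatch (GU.Adj u w) (GU.Adj v w) ≤ ε / 5 * n)
    (hw : weight GK (label GK η) = weight GU (label GU C)) (ρ : V → ℕ)
    (hinj : ∀ v v', label GU C v = label GU C v' → ρ v = ρ v' → v = v')
    (hlt : ∀ v, ρ v < #{w | label GU C w = label GU C v}) :
    IsApproxIso GU GK ε
      (fun v => ({w | label GK η w = label GU C v} : Finset (Fin n)).toList[ρ v]?) := by
  set Q : (Fin m → Bool) → List (Fin n) := fun l =>
    ({w | label GK η w = l} : Finset (Fin n)).toList with hQ
  have hlen : ∀ v, ρ v < (Q (label GU C v)).length := by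
    intro v
    have := congrFun hw (Sum.inl (label GU C v))
    simp only [weight, Sum.elim_inl] at this
    rw [hQ, length_toList]
    refine (hlt v).trans_eq ?_
    convert this.symm
  set g : V → Fin n := fun v => (Q (label GU C v))[ρ v]'(hlen v) with hg
  have hlab : ∀ v, label GK η (g v) = label GU C v := by
    intro v
    have : g v ∈ Q (label GU C v) := List.getElem_mem _
    simpa [hQ] using this
  have hginj : Function.Injective g := by
    intro v v' h
    have hl : label GU C v = label GU C v' := by rw [← hlab, ← hlab, h]
    refine hinj v v' hl ?_
    have hnd : (Q (label GU C v)).Nodup := nodup_toList _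
    have hlen' := hlen v'
    simp only [hg, ← hl] at h hlen'
    exact (hnd.getElem_inj_iff (hi := hlen v) (hj := hlen')).1 h
  have hbij : Function.Bijective g := by
    rw [Fintype.bijective_iff_injective_and_card]
    exact ⟨hginj, by simpa using hV⟩
  refine ⟨Equiv.ofBijective g hbij, fun v => List.getElem?_eq_getElem (hlen v), ?_⟩
  have h1 := adjDist_le_of_weight_eq hw.symm (Equiv.ofBijective g hbij) hlab hgood
  refine h1.trans_lt ?_
  rw [hV]
  -- The bound is `4 * (n * (ε / 5 * n))`, which explains the tolerance `ε / 5`.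
  have : 0 < ε * (n : ℝ) ^ 2 := by positivity
  nlinarith

/-! ### The algorithm -/

open Classical in
/-- A realizable map which gives an approximate isomorphism for all samples which distinguish nodes
with rather different neighbourhoods. -/
theorem exists_approxIso {n m k D N a b : ℕ} [NeZero n] [NeZero N] (hN : N ≤ 2 ^ b)
    (hnN : n + n ^ 2 < N) (hab : n ^ a + 1 ≤ 2 ^ b) (hk : (n ^ m) ^ 2 < 2 ^ k)
    (GK : SimpleGraph (Fin n)) (ε : ℝ) (hε : 0 < ε) :
    ∃ F : NetFun.{u} (ℕ × (Fin m → Fin n)) (Option (Fin n)),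
      Realizable b (8 * D + 3 * m + 2 * k + 3) F ∧
      ∀ (V : Type u) [Fintype V] (GU : SimpleGraph V) (P : PortNumbering GU) (ident : V → ℕ),
        GU.Connected → (∀ u v, GU.dist u v ≤ D) → Nonempty (GU ≃g GK) →
        Function.Injective ident → (∀ v, ident v ≤ n ^ a) →
        ∃ (r : V) (e : V ≃ Fin n), ∀ ω : V → Fin m → Fin n,
          (∀ u v, label GU (fun i => e.symm (ω r i)) u = label GU (fun i => e.symm (ω r i)) v →
            ∑ w, mismatch (GU.Adj u w) (GU.Adj v w) ≤ ε / 5 * n) →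
          IsApproxIso GU GK ε (F P fun v => (ident v, ω v)) := by
  obtain ⟨h, hh⟩ := exists_separating (fun η : Fin m → Fin n => weight GK (label GK η)) k
    (by simpa using hk)
  obtain ⟨F₁, hF₁, hS₁⟩ := exists_sampling.{u} (m := m) (D := D) (a := a)
    (by omega : n < N) hN hab
  obtain ⟨F₂, hF₂, hS₂⟩ := exists_fingerprint.{u} (D := D) hN h
  obtain ⟨F₃, hF₃, hS₃⟩ := exists_ranking.{u} (m := m) (D := D) hN
  -- Any tuple with the right fingerprint will do; it need not be the image of the sample under an
  -- isomorphism.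
  set guess : (Fin k → ℕ) → Fin m → Fin n := fun φ =>
    if hη : ∃ η : Fin m → Fin n, (fun j => ∑ z with h j z, weight GK (label GK η) z) = φ
      then hη.choose else 0 with hguess
  have hq := ((hF₁.extend (fun y => (y.1, y.2.1, y.2.2.1)) hF₂).extend (fun y => y.1) hF₃).map
    (fun _ y => ({w | label GK (guess y.1.2) w = y.1.1.2.1} : Finset (Fin n)).toList[y.2]?)
  have hT : D + (D + 1 + D) + (m + D) + m + m + (k + D + (k + D)) + (1 + (D + 1 + D)) =
      8 * D + 3 * m + 2 * k + 3 := by ring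
  rw [hT] at hq
  refine ⟨_, hq, ?_⟩
  clear hq
  intro V _ GU P ident hG hD ⟨e₀⟩ hinj hid
  have hV : Fintype.card V = n := by simpa using Fintype.card_congr e₀.toEquiv
  obtain ⟨r, e, tr, htree, hS₁⟩ := hS₁ V GU P ident hG hD hV hinj hid
  refine ⟨r, e, fun ω hgood => ?_⟩
  obtain ⟨nb, bits, hF, hnb, hbits⟩ := hS₁ ω
  set C : Fin m → V := fun i => e.symm (ω r i) with hC
  have h2 := hS₂ V GU P r tr (label GU C) nb htree (by rw [hV]; exact hnN) hnb
  obtain ⟨h3, h4⟩ := hS₃ V GU P r tr C nb bits htree (by rw [hV]; omega) hnb hbits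
  simp only [hF, h2]
  refine isApproxIso_toList hV (NeZero.pos n) hε C _ hgood ?_ _ h3 h4
  -- The image of the sample shows that a candidate exists, and brings the weights of `GU` into the
  -- family that the fingerprints separate.
  have hex : weight GK (label GK (fun i => e₀ (C i))) = weight GU (label GU C) := by
    rw [← weight_comp_iso GU GK e₀]
    congr 1
    funext v i
    simp [label, e₀.map_adj_iff]
  have hη : ∃ η : Fin m → Fin n, (fun j => ∑ z with h j z, weight GK (label GK η) z) =
      fun j => ∑ z with h j z, weight GU (label GU C) z := ⟨_, by rw [hex]⟩
  simp only [hguess]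
  rw [dif_pos hη]
  refine (hh _ (fun i => e₀ (C i)) fun j => ?_).trans hex
  rw [congrFun hη.choose_spec j, hex]

/-! ### Probability, message length and number of rounds -/

open Classical in
-- A coordinate of a uniform function is uniform, in a form free of division.
theorem card_filter_apply_mul {V S : Type*} [Fintype V] [Fintype S] (r : V) (p : S → Prop) :
    #{ω : V → S | p (ω r)} * Fintype.card S = #{s | p s} * Fintype.card (V → S) := by
  have h1 : #{ω : V → S | p (ω r)} =
      #(({s | p s} : Finset S) ×ˢ (univ : Finset ({j // j ≠ r} → S))) :=
    card_equiv (Equiv.funSplitAt r S) (by simp)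
  rw [h1, card_product, card_univ, Fintype.card_congr (Equiv.funSplitAt r S), Fintype.card_prod]
  ring

open Classical in
/-- The samples fail with small probability. -/
theorem one_sub_le_prob {V : Type*} [Fintype V] {n m c : ℕ} (hn : 0 < n)
    (hV : Fintype.card V = n) (G : SimpleGraph V) (r : V) (e : V ≃ Fin n) {δ : ℝ} (hδ : δ < 1)
    (hm : (c + 2) * Real.log n ≤ δ * m) (E : (V → Fin m → Fin n) → Prop)
    (hE : ∀ ω, (∀ u v, label G (fun i => e.symm (ω r i)) u = label G (fun i => e.symm (ω r i)) v →
      ∑ w, mismatch (G.Adj u w) (G.Adj v w) ≤ δ * n) → E ω) :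
    1 - 1 / (n : ℝ) ^ c ≤
      ({ω | E ω}.ncard : ℝ) / (Nat.card (V → Fin m → Fin n) : ℝ) := by
  set bad : (Fin m → V) → Prop := fun C => ∃ u v, label G C u = label G C v ∧
    δ * n < ∑ w, mismatch (G.Adj u w) (G.Adj v w) with hbad
  set bad' : (Fin m → Fin n) → Prop := fun s => bad (fun i => e.symm (s i)) with hbad'
  have hn0 : (0 : ℝ) < n := by exact_mod_cast hn
  have h1 : (#{C | bad C} : ℝ) ≤ (n : ℝ) ^ m / (n : ℝ) ^ c := by
    have := card_bad_sample_le G m c δ hδ (by rwa [hV]) (by rwa [hV])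
    rw [hV] at this
    convert this
  have h2 : #{s | bad' s} = #{C | bad C} :=
    card_equiv ((Equiv.refl (Fin m)).arrowCongr e.symm) (fun s => by
      simp only [mem_filter, mem_univ, true_and, hbad']
      rfl)
  have h3 : (#{ω : V → Fin m → Fin n | bad' (ω r)} : ℝ) * (n : ℝ) ^ m =
      #{s | bad' s} * Fintype.card (V → Fin m → Fin n) := by
    have := card_filter_apply_mul (V := V) r bad'
    rw [Fintype.card_fun (α := Fin m), Fintype.card_fin, Fintype.card_fin] at this
    have h : #{ω : V → Fin m → Fin n | bad' (ω r)} * n ^ m =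
        #{s | bad' s} * Fintype.card (V → Fin m → Fin n) := by convert this
    exact_mod_cast h
  set T : ℝ := (Fintype.card (V → Fin m → Fin n) : ℝ) with hT
  have hT0 : 0 < T := by
    have : Nonempty (V → Fin m → Fin n) := ⟨fun _ _ => ⟨0, hn⟩⟩
    exact Nat.cast_pos.2 Fintype.card_pos
  have h4 : (#{ω : V → Fin m → Fin n | bad' (ω r)} : ℝ) ≤ 1 / (n : ℝ) ^ c * T := by
    have hnm : (0 : ℝ) < (n : ℝ) ^ m := by positivity
    refine le_of_mul_le_mul_right ?_ hnm
    rw [h3, h2]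
    calc _ ≤ (n : ℝ) ^ m / (n : ℝ) ^ c * T := by gcongr
      _ = _ := by ring
  have h5 : T ≤ ({ω | E ω}.ncard : ℝ) + #{ω : V → Fin m → Fin n | bad' (ω r)} := by
    rw [Set.ncard_eq_toFinset_card', hT, ← card_univ]
    have : (univ : Finset (V → Fin m → Fin n)) ⊆
        {ω | E ω}.toFinset ∪ ({ω | bad' (ω r)} : Finset _) := by
      intro ω _
      simp only [mem_union, Set.mem_toFinset, Set.mem_ofPred_eq, mem_filter, mem_univ, true_and]
      by_contra hcon
      push Not at hcon
      refine hcon.1 (hE ω fun u v huv => ?_)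
      by_contra hlt
      exact hcon.2 ⟨u, v, huv, not_le.1 hlt⟩
    exact_mod_cast (card_le_card this).trans (card_union_le _ _)
  rw [Nat.card_eq_fintype_card, ← hT, le_div_iff₀ hT0]
  linarith

/-- The dominant term is `k = O(ε⁻¹ (log n)²)`. Smaller terms are absorbed because `ε⁻¹ log n` is at
least `1 / 2`. -/
theorem rounds_le {n c m k D : ℕ} (hn : 2 ≤ n) {ε : ℝ} (hε0 : 0 < ε) (hε1 : ε < 1)
    (hm : m = ⌈5 * (c + 2) * (ε⁻¹ * Real.log n)⌉₊) (hk : k = 2 * m * Nat.clog 2 n + 1) :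
    ((8 * D + 3 * m + 2 * k + 3 : ℕ) : ℝ) ≤
      (22 * (5 * c + 12) + 20) * (D + (ε⁻¹ * Real.log n) ^ 2) := by
  have hn' : (2 : ℝ) ≤ n := by exact_mod_cast hn
  set L : ℝ := ε⁻¹ * Real.log n with hL
  have hlog2 : (1 / 2 : ℝ) ≤ Real.log 2 := by linarith [Real.log_two_gt_d9]
  have hlog : (1 / 2 : ℝ) ≤ Real.log n := hlog2.trans (Real.log_le_log two_pos hn')
  have hlogL : Real.log n ≤ L :=
    le_mul_of_one_le_left (by linarith) ((one_le_inv₀ hε0).2 hε1.le)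
  have hLh : 1 / 2 ≤ L := hlog.trans hlogL
  have hm1 : (m : ℝ) ≤ (5 * c + 12) * L := by
    have := Nat.ceil_lt_add_one (a := 5 * ((c : ℝ) + 2) * L) (by positivity)
    rw [← hm] at this
    nlinarith
  have hclog : (Nat.clog 2 n : ℝ) ≤ 4 * L := by
    have h1 : Nat.clog 2 n ≤ Nat.log 2 n + 1 :=
      Nat.clog_le_of_le_pow (Nat.lt_pow_succ_log_self one_lt_two n).le
    have h2 : (Nat.log 2 n : ℝ) * Real.log 2 ≤ Real.log n := by
      rw [← Real.log_pow]
      refine Real.log_le_log (by positivity) ?_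
      exact_mod_cast Nat.pow_log_le_self 2 (by omega)
    have h3 : (Nat.clog 2 n : ℝ) ≤ Nat.log 2 n + 1 := by exact_mod_cast h1
    have h4 : (0 : ℝ) ≤ Nat.log 2 n := Nat.cast_nonneg _
    nlinarith
  have hk1 : (k : ℝ) ≤ 2 * ((5 * c + 12) * L) * (4 * L) + 1 := by
    rw [hk]
    push_cast
    gcongr
  have hD : (0 : ℝ) ≤ D := Nat.cast_nonneg _
  have hc : (0 : ℝ) ≤ c := Nat.cast_nonneg _
  have hLL : L ≤ 2 * L ^ 2 := by nlinarith
  have hM : (5 * c + 12) * L ≤ (5 * c + 12) * (2 * L ^ 2) :=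
    mul_le_mul_of_nonneg_left hLL (by positivity)
  have h1L : 1 ≤ 4 * L ^ 2 := by nlinarith
  have hDc : 8 * (D : ℝ) ≤ (22 * (5 * c + 12) + 20) * D :=
    mul_le_mul_of_nonneg_right (by linarith) hD
  -- With `M = 5 * c + 12`: `3 * m ≤ 6 * M * L ^ 2`, `2 * k ≤ 16 * M * L ^ 2 + 2`, and the remaining
  -- `5` is at most `20 * L ^ 2`.
  push_cast
  rw [mul_add]
  nlinarith

end Congest

/-! ### Diameters of isomorphic graphs -/

namespace SimpleGraph

theorem edist_map_le {V W : Type*} {G : SimpleGraph V} {H : SimpleGraph W} (f : G →g H) (u v : V) :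
    H.edist (f u) (f v) ≤ G.edist u v := by
  refine le_iInf fun w => (edist_le (w.map f)).trans ?_
  rw [Walk.length_map]

theorem Iso.ediam_le {V W : Type*} {G : SimpleGraph V} {H : SimpleGraph W} (e : G ≃g H) :
    G.ediam ≤ H.ediam := by
  refine ediam_le_of_edist_le fun u v => ?_
  have := edist_map_le e.symm.toHom (e u) (e v)
  simp only [Iso.toHom, RelIso.coe_toRelEmbedding, RelEmbedding.coe_toRelHom,
    RelIso.symm_apply_apply] at this
  exact this.trans edist_le_ediam

theorem Iso.diam_eq {V W : Type*} {G : SimpleGraph V} {H : SimpleGraph W} (e : G ≃g H) :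
    G.diam = H.diam := by
  rw [diam, diam, le_antisymm e.ediam_le e.symm.ediam_le]

end SimpleGraph

/-! ### The main theorem -/

theorem mainTheorem5 (c a : ℕ) :
    ∃ (B : ℕ) (K : ℝ)
      (A : (n : ℕ) → SimpleGraph (Fin n) → ℝ →
        Congest.Algorithm (B * Nat.clog 2 n) (Fin n)),
      ∀ (V : Type*) (n : ℕ) (GU : SimpleGraph V) (GK : SimpleGraph (Fin n)) (ε : ℝ),
        GU.Connected → Nonempty (GU ≃g GK) → 0 < ε → ε < 1 →
        ((A n GK ε).rounds : ℝ) ≤ K * ((GU.diam : ℝ) + (ε⁻¹ * Real.log n) ^ 2) ∧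
        ∀ (P : Congest.PortNumbering GU) (ident : V → ℕ),
          Function.Injective ident → (∀ v, ident v ≤ n ^ a) →
          1 - 1 / (n : ℝ) ^ c ≤
            (A n GK ε).prob P ident (Congest.IsApproxIso GU GK ε) := by
  suffices h : ∀ (n : ℕ) (GK : SimpleGraph (Fin n)) (ε : ℝ),
      ∃ A : Congest.Algorithm ((a + 3) * Nat.clog 2 n) (Fin n),
        ∀ (V : Type _) (GU : SimpleGraph V), GU.Connected → Nonempty (GU ≃g GK) → 0 < ε → ε < 1 →
          (A.rounds : ℝ) ≤
            (22 * (5 * c + 12) + 20) * ((GU.diam : ℝ) + (ε⁻¹ * Real.log n) ^ 2) ∧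
          ∀ (P : Congest.PortNumbering GU) (ident : V → ℕ),
            Function.Injective ident → (∀ v, ident v ≤ n ^ a) →
            1 - 1 / (n : ℝ) ^ c ≤ A.prob P ident (Congest.IsApproxIso GU GK ε) by
    choose A hA using h
    exact ⟨a + 3, _, A, fun V n GU GK ε => hA n GK ε V GU⟩
  intro n GK ε
  by_cases hcase : 2 ≤ n ∧ 0 < ε ∧ ε < 1
  · obtain ⟨hn, hε0, hε1⟩ := hcase
    have : NeZero n := ⟨by omega⟩
    -- Then `n ^ (a + 3) ≤ 2 ^ b`, which leaves room for identifiers up to `n ^ a` and for counts up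
    -- to `n + n ^ 2`.
    set b := (a + 3) * Nat.clog 2 n with hb
    have hpow : n ^ (a + 3) ≤ 2 ^ b := by
      rw [hb, mul_comm, pow_mul]
      exact Nat.pow_le_pow_left (Nat.le_pow_clog one_lt_two n) _
    have hna : 1 ≤ n ^ a := Nat.one_le_pow _ _ (by omega)
    have hN : n + n ^ 2 + 1 ≤ 2 ^ b := by
      refine le_trans ?_ hpow
      rw [pow_add]
      calc n + n ^ 2 + 1 ≤ 1 * n ^ 3 := by nlinarith [Nat.pow_le_pow_left hn 2]
        _ ≤ _ := Nat.mul_le_mul_right _ hna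
    have hab : n ^ a + 1 ≤ 2 ^ b := by
      refine le_trans ?_ hpow
      rw [pow_add]
      have : 2 ≤ n ^ 3 := by nlinarith [Nat.pow_le_pow_left hn 2]
      nlinarith
    obtain ⟨m, hm⟩ : ∃ m, m = ⌈5 * ((c : ℝ) + 2) * (ε⁻¹ * Real.log n)⌉₊ := ⟨_, rfl⟩
    obtain ⟨k, hk⟩ : ∃ k, k = 2 * m * Nat.clog 2 n + 1 := ⟨_, rfl⟩
    -- There are `n ^ m` candidate samples in `GK`, and all pairs of them have to be separated.
    have hk' : (n ^ m) ^ 2 < 2 ^ k := by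
      calc (n ^ m) ^ 2 ≤ ((2 ^ Nat.clog 2 n) ^ m) ^ 2 := by
            gcongr
            exact Nat.le_pow_clog one_lt_two n
        _ = 2 ^ (2 * m * Nat.clog 2 n) := by rw [← pow_mul, ← pow_mul]; ring_nf
        _ < 2 ^ k := Nat.pow_lt_pow_right one_lt_two (by omega)
    obtain ⟨F, hF, hspec⟩ := Congest.exists_approxIso (m := m) (D := GK.diam) (a := a)
      (N := n + n ^ 2 + 1) hN (by omega) hab hk' GK ε hε0
    obtain ⟨A, hA, hprob⟩ := hF.exists_algorithm
    refine ⟨A, fun V GU hG he _ _ => ?_⟩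
    obtain ⟨e₀⟩ := id he
    rw [hA, e₀.diam_eq]
    refine ⟨Congest.rounds_le hn hε0 hε1 hm hk, fun P ident hinj hid => ?_⟩
    have : Fintype V := Fintype.ofEquiv _ e₀.symm.toEquiv
    have hV : Fintype.card V = n := by simpa using Fintype.card_congr e₀.toEquiv
    have := hG.nonempty
    have hdist : ∀ u v, GU.dist u v ≤ GK.diam := fun u v => e₀.diam_eq ▸
      SimpleGraph.dist_le_diam (SimpleGraph.connected_iff_ediam_ne_top.1 hG)
    obtain ⟨r, e, hgood⟩ := hspec V GU P ident hG hdist he hinj hid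
    rw [hprob]
    refine Congest.one_sub_le_prob (by omega) hV GU r e (δ := ε / 5) (by linarith) ?_ _ hgood
    have := Nat.le_ceil (5 * ((c : ℝ) + 2) * (ε⁻¹ * Real.log n))
    rw [← hm] at this
    calc ((c : ℝ) + 2) * Real.log n
        = ε / 5 * (5 * ((c : ℝ) + 2) * (ε⁻¹ * Real.log n)) := by field_simp
      _ ≤ _ := by gcongr
  -- For admissible `ε` only `n = 1` remains, where the claimed probability is `1 - 1 = 0`; an
  -- algorithm without rounds or outputs suffices.
  · obtain ⟨A, hA, -⟩ := Congest.Realizable.exists_algorithm.{0} (Seed := Unit) (Out := Fin n)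
      (b := (a + 3) * Nat.clog 2 n) (Congest.Realizable.loc fun _ _ => none)
    refine ⟨A, fun V GU hG ⟨e₀⟩ hε0 hε1 => ?_⟩
    rw [hA]
    refine ⟨by rw [Nat.cast_zero]; positivity, fun P ident _ _ => ?_⟩
    have hn1 : n = 1 := by
      obtain ⟨v⟩ := hG.nonempty
      have := (e₀ v).2
      by_contra hne
      exact hcase ⟨by omega, hε0, hε1⟩
    subst hn1
    simp only [Nat.cast_one, one_pow, div_one, sub_self]
    exact div_nonneg (Nat.cast_nonneg _) (Nat.cast_nonneg _)
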